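/- Let $E$ be a finite-dimensional complex Hilbert space, $F$ a finite-dimensional real Hilbert space with complexification $F_{\mathbb C}$ and dual $F'$, and let $\Phi\colon E\times E\to F_{\mathbb C}$ be a hermitian map (sesquilinear, linear in the first variable, with $\Phi(\zeta',\zeta)=\overline{\Phi(\zeta,\zeta')}$). Write $\Phi(\zeta)=\Phi(\zeta,\zeta)\in F$ and $\rho(\zeta,z)=\operatorname{Im} z-\Phi(\zeta)$, and let $\mathcal N=E\times F$, endowed with Lebesgue measure. For a function $f$ on $E\times F_{\mathbb C}$ let $f_0(\zeta,x)=f(\zeta,x+i\Phi(\zeta))$ for $(\zeta,x)\in\mathcal N$. For a compact convex set $K\subseteq F'$ (possibly empty) let $H_K(h)=\sup_{\lambda\in -K}\langle\lambda,h\rangle\in[-\infty,\infty)$ for $h\in F$. For a compact convex set $K\subseteq F'$ and $p\in(0,\infty]$, the Bernstein space $\mathcal B^p_K(\mathcal N)$ is the space of all holomorphic functions $f$ on $E\times F_{\mathbb C}$ such that $f_0\in L^p(\mathcal N)$ and such that for every $\varepsilon>0$ there is $C_\varepsilon>0$ with $$|f(\zeta,z)|\le C_\varepsilon\, e^{C_\varepsilon(|\zeta|^2+|\operatorname{Re}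 z|)+H_{K+\overline B_{F'}(0,\varepsilon)}(\rho(\zeta,z))}\qquad\text{for all }(\zeta,z)\in E\times F_{\mathbb C}.$$ It is endowed with $\|f\|_{\mathcal B^p_K}=\|f_0\|_{L^p(\mathcal N)}$. Then, for every compact convex set $K\subseteq F'$ and every $p\in(0,\infty]$, $\|\cdot\|_{\mathcal B^p_K}$ is a quasi-norm for which $\mathcal B^p_K(\mathcal N)$ is complete, that is, $\mathcal B^p_K(\mathcal N)$ is a quasi-Banach space; if $p\ge 1$, it is a norm and $\mathcal B^p_K(\mathcal N)$ is a Banach space. Moreover, the inclusion of $\mathcal B^p_K(\mathcal N)$ in the space $\operatorname{Hol}(E\times F_{\mathbb C})$ of holomorphic functions, with the topology of locally uniform convergence, is continuous. -/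

import Mathlib

open MeasureTheory Set Topology
open scoped ENNReal Pointwise

set_option linter.unusedSectionVars false

noncomputable section

/-- The complexification `F_ℂ = F ⊕ iF` of a real inner product space `F`: pairs `(x, y)`, standing
for `x + iy`, with norm `|x + iy|² = |x|² + |y|²`. -/
def Cplx (F : Type*) : Type _ := WithLp 2 (F × F)

namespace Cplx

variable {F : Type*} [NormedAddCommGroup F] [InnerProductSpace ℝ F]

instance : NormedAddCommGroup (Cplx F) := inferInstanceAs (NormedAddCommGroup (WithLp 2 (F × F)))

/-- The element `x + iy` of `F_ℂ`. -/
def mk (x y : F) : Cplx F := WithLp.toLp 2 (x, y)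

/-- The real part. -/
def re (z : Cplx F) : F := (WithLp.ofLp z).1

/-- The imaginary part. -/
def im (z : Cplx F) : F := (WithLp.ofLp z).2

/-- The conjugate `x - iy` of `x + iy`. -/
def conj (z : Cplx F) : Cplx F := mk z.re (-z.im)

@[simp] theorem re_mk (x y : F) : (mk x y).re = x := rfl
@[simp] theorem im_mk (x y : F) : (mk x y).im = y := rfl
@[simp] theorem re_add (z w : Cplx F) : (z + w).re = z.re + w.re := rfl
@[simp] theorem im_add (z w : Cplx F) : (z + w).im = z.im + w.im := rfl
@[simp] theorem re_zero : (0 : Cplx F).re = 0 := rfl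
@[simp] theorem im_zero : (0 : Cplx F).im = 0 := rfl

theorem ext {z w : Cplx F} (h₁ : z.re = w.re) (h₂ : z.im = w.im) : z = w :=
  WithLp.ofLp_injective 2 (Prod.ext h₁ h₂)

theorem norm_sq_eq (z : Cplx F) : ‖z‖ ^ 2 = ‖z.re‖ ^ 2 + ‖z.im‖ ^ 2 :=
  WithLp.prod_norm_sq_eq_of_L2 (α := F) (β := F) z

/-- `(a + ib)(x + iy) = (ax - by) + i(ay + bx)`. -/
instance : SMul ℂ (Cplx F) where
  smul c z := mk (c.re • z.re - c.im • z.im) (c.re • z.im + c.im • z.re)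

@[simp] theorem re_smul (c : ℂ) (z : Cplx F) : (c • z).re = c.re • z.re - c.im • z.im := rfl
@[simp] theorem im_smul (c : ℂ) (z : Cplx F) : (c • z).im = c.re • z.im + c.im • z.re := rfl

instance : Module ℂ (Cplx F) where
  one_smul z := ext (by simp) (by simp)
  mul_smul a b z := ext (by simp; module) (by simp; module)
  smul_zero a := ext (by simp) (by simp)
  smul_add a z w := ext (by simp; module) (by simp; module)
  add_smul a b z := ext (by simp; module) (by simp; module)
  zero_smul z := ext (by simp) (by simp)

instance : NormedSpace ℂ (Cplx F) where
  norm_smul_le c z := by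
    apply le_of_eq
    rw [← sq_eq_sq₀ (by positivity) (by positivity), mul_pow, norm_sq_eq, norm_sq_eq,
      ← Complex.normSq_eq_norm_sq, Complex.normSq_apply, re_smul, im_smul,
      norm_sub_sq_real, norm_add_sq_real]
    simp only [inner_smul_left, inner_smul_right, norm_smul, mul_pow, Real.norm_eq_abs, sq_abs,
      real_inner_comm, RCLike.conj_to_real]
    ring

theorem continuous_re : Continuous (re : Cplx F → F) :=
  (WithLp.prod_continuous_ofLp 2 F F).fst

theorem continuous_im : Continuous (im : Cplx F → F) :=
  (WithLp.prod_continuous_ofLp 2 F F).snd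

theorem continuous_mk : Continuous (fun q : F × F => mk q.1 q.2) :=
  WithLp.prod_continuous_toLp 2 F F

end Cplx

/-- A hermitian map `Φ : E × E → F_ℂ`: sesquilinear (linear in the first variable, antilinear in
the second one), with `Φ(ζ', ζ)` the conjugate of `Φ(ζ, ζ')`. -/
structure HermitianMap (E F : Type*) [NormedAddCommGroup E] [InnerProductSpace ℂ E]
    [NormedAddCommGroup F] [InnerProductSpace ℝ F] where
  /-- The underlying sesquilinear map. -/
  toFun : E →ₗ[ℂ] E →ₗ⋆[ℂ] Cplx F
  conj_symm : ∀ ζ ζ' : E, toFun ζ' ζ = (toFun ζ ζ').conj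

/-- A quasi-norm on a complex vector space. -/
structure IsQuasiNorm {V : Type*} [AddCommGroup V] [Module ℂ V] (q : V → ℝ) : Prop where
  nonneg : ∀ x, 0 ≤ q x
  eq_zero_iff : ∀ x, q x = 0 ↔ x = 0
  smul : ∀ (c : ℂ) (x : V), q (c • x) = ‖c‖ * q x
  add_le : ∃ C : ℝ, 1 ≤ C ∧ ∀ x y, q (x + y) ≤ C * (q x + q y)

namespace IsQuasiNorm

variable {V : Type*} [AddCommGroup V] [Module ℂ V] {q : V → ℝ}

theorem map_sub_comm (hq : IsQuasiNorm q) (x y : V) : q (x - y) = q (y - x) := by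
  have h := hq.smul (-1) (y - x)
  simpa using h

/-- The sets `{(x, y) | q (x - y) < ε}`, for `ε > 0`. -/
def filterBasis (_ : IsQuasiNorm q) : FilterBasis (V × V) where
  sets := {s | ∃ ε > 0, s = {z : V × V | q (z.1 - z.2) < ε}}
  nonempty := ⟨_, 1, one_pos, rfl⟩
  inter_sets := by
    rintro _ _ ⟨ε, hε, rfl⟩ ⟨δ, hδ, rfl⟩
    refine ⟨_, ⟨min ε δ, lt_min hε hδ, rfl⟩, fun z hz => ?_⟩
    have hz' : q (z.1 - z.2) < min ε δ := hz
    exact ⟨hz'.trans_le (min_le_left _ _), hz'.trans_le (min_le_right _ _)⟩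

/-- The uniform structure defined by a quasi-norm `q`: its entourages are the sets that contain
`{(x, y) | q (x - y) < ε}` for some `ε > 0`. Its topology is the one defined by `q`. -/
@[reducible] def uniformSpace (hq : IsQuasiNorm q) : UniformSpace V :=
  UniformSpace.ofCore <| UniformSpace.Core.mkOfBasis hq.filterBasis
    (by
      rintro _ ⟨ε, hε, rfl⟩ x
      have h0 : q 0 = 0 := (hq.eq_zero_iff 0).2 rfl
      simpa [h0] using hε)
    (by
      rintro _ ⟨ε, hε, rfl⟩
      refine ⟨_, ⟨ε, hε, rfl⟩, fun z hz => ?_⟩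
      change q (z.2 - z.1) < ε
      rw [hq.map_sub_comm]
      exact hz)
    (by
      rintro _ ⟨ε, hε, rfl⟩
      obtain ⟨C, hC, hadd⟩ := hq.add_le
      have hC0 : 0 < C := by linarith
      refine ⟨_, ⟨ε / (2 * C), by positivity, rfl⟩, ?_⟩
      rintro ⟨x, z⟩ ⟨y, hxy, hyz⟩
      change q (x - z) < ε
      change q (x - y) < ε / (2 * C) at hxy
      change q (y - z) < ε / (2 * C) at hyz
      have h := hadd (x - y) (y - z)
      rw [sub_add_sub_cancel] at h
      calc q (x - z) ≤ C * (q (x - y) + q (y - z)) := h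
        _ < C * (ε / (2 * C) + ε / (2 * C)) := by gcongr
        _ = ε := by field_simp; norm_num)

end IsQuasiNorm

section Bernstein

variable {E F : Type*} [NormedAddCommGroup E] [InnerProductSpace ℂ E]
  [NormedAddCommGroup F] [InnerProductSpace ℝ F]

/-- The supporting function `H_K(h) = sup_{λ ∈ -K} ⟨λ, h⟩ ∈ [-∞, ∞)`; it is `-∞` for `K = ∅`. -/
def suppFun (K : Set (StrongDual ℝ F)) (h : F) : EReal := ⨆ l ∈ -K, ((l h : ℝ) : EReal)

/-- The space `Hol(E × F_ℂ)` of entire functions, with the compact-open topology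
(locally uniform convergence). -/
def Hol (E F : Type*) [NormedAddCommGroup E] [InnerProductSpace ℂ E]
    [NormedAddCommGroup F] [InnerProductSpace ℝ F] : Submodule ℂ C(E × Cplx F, ℂ) where
  carrier := {f | Differentiable ℂ f}
  add_mem' hf hg := Differentiable.add hf hg
  zero_mem' := differentiable_const 0
  smul_mem' c _ hf := Differentiable.const_smul hf c

namespace HermitianMap

/-- `Φ(ζ) = Φ(ζ, ζ)`, which is an element of `F`. -/
def diag (Φ : HermitianMap E F) (ζ : E) : F := (Φ.toFun ζ ζ).re

/-- `Φ(ζ, ζ)` is real. -/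
theorem toFun_self (Φ : HermitianMap E F) (ζ : E) : Φ.toFun ζ ζ = Cplx.mk (Φ.diag ζ) 0 := by
  refine Cplx.ext rfl ?_
  have h : (Φ.toFun ζ ζ).im = -(Φ.toFun ζ ζ).im := congrArg Cplx.im (Φ.conj_symm ζ ζ)
  have h2 : (2 : ℝ) • (Φ.toFun ζ ζ).im = 0 := by
    rw [two_smul]; nth_rewrite 1 [h]; simp
  simpa using h2

/-- `ρ(ζ, z) = Im z - Φ(ζ)`. -/
def rho (Φ : HermitianMap E F) (ζ : E) (z : Cplx F) : F := z.im - Φ.diag ζ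

/-- `f_h(ζ, x) = f(ζ, x + iΦ(ζ) + ih)`, as a function on `𝒩 = E × F`. -/
def restr (Φ : HermitianMap E F) (f : E × Cplx F → ℂ) (h : F) (ξ : E × F) : ℂ :=
  f (ξ.1, Cplx.mk ξ.2 (Φ.diag ξ.1 + h))

/-- The exponential growth condition of type `K`: for every `ε > 0` there is `C > 0` such that
`|f(ζ, z)| ≤ C exp(C(|ζ|² + |Re z|) + H_{K + B(0, ε)}(ρ(ζ, z)))` for all `(ζ, z)`. -/
def ExpType (Φ : HermitianMap E F) (K : Set (StrongDual ℝ F)) (f : E × Cplx F → ℂ) : Prop :=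
  ∀ ε : ℝ, 0 < ε → ∃ C : ℝ, 0 < C ∧ ∀ (ζ : E) (z : Cplx F),
    ‖f (ζ, z)‖ₑ ≤ ENNReal.ofReal C * EReal.exp
      (((C * (‖ζ‖ ^ 2 + ‖z.re‖) : ℝ) : EReal) +
        suppFun (K + Metric.closedBall (0 : StrongDual ℝ F) ε) (Φ.rho ζ z))

theorem ExpType.zero (Φ : HermitianMap E F) (K : Set (StrongDual ℝ F)) :
    Φ.ExpType K (fun _ => 0) :=
  fun _ _ => ⟨1, one_pos, fun _ _ => by simp⟩

theorem ExpType.add {Φ : HermitianMap E F} {K : Set (StrongDual ℝ F)} {f g : E × Cplx F → ℂ}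
    (hf : Φ.ExpType K f) (hg : Φ.ExpType K g) : Φ.ExpType K (fun w => f w + g w) := by
  intro ε hε
  obtain ⟨C, hC, h₁⟩ := hf ε hε
  obtain ⟨D, hD, h₂⟩ := hg ε hε
  refine ⟨C + D, by positivity, fun ζ z => (enorm_add_le _ _).trans ?_⟩
  rw [ENNReal.ofReal_add hC.le hD.le, add_mul]
  have hX : 0 ≤ ‖ζ‖ ^ 2 + ‖z.re‖ := by positivity
  refine add_le_add ((h₁ ζ z).trans ?_) ((h₂ ζ z).trans ?_)
  · refine mul_le_mul_right (EReal.exp_monotone (add_le_add_left (EReal.coe_le_coe ?_) _)) _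
    nlinarith
  · refine mul_le_mul_right (EReal.exp_monotone (add_le_add_left (EReal.coe_le_coe ?_) _)) _
    nlinarith

theorem ExpType.smul {Φ : HermitianMap E F} {K : Set (StrongDual ℝ F)} {f : E × Cplx F → ℂ}
    (c : ℂ) (hf : Φ.ExpType K f) : Φ.ExpType K (fun w => c * f w) := by
  intro ε hε
  obtain ⟨C, hC, h₁⟩ := hf ε hε
  refine ⟨(‖c‖ + 1) * C, by positivity, fun ζ z => ?_⟩
  have hX : 0 ≤ ‖ζ‖ ^ 2 + ‖z.re‖ := by positivity
  have hc : C ≤ (‖c‖ + 1) * C := by nlinarith [norm_nonneg c]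
  rw [enorm_mul, ENNReal.ofReal_mul (by positivity), mul_assoc]
  refine mul_le_mul' ?_ ((h₁ ζ z).trans ?_)
  · rw [← ofReal_norm]
    exact ENNReal.ofReal_le_ofReal (by linarith)
  · refine mul_le_mul_right (EReal.exp_monotone (add_le_add_left (EReal.coe_le_coe ?_) _)) _
    exact mul_le_mul_of_nonneg_right hc hX

end HermitianMap

/-- Lebesgue measure on `𝒩 = E × F`, where `E` is regarded as a real inner product space for the
scalar product `Re ⟨ζ, ζ'⟩`. -/
def lebesgue (E F : Type*) [NormedAddCommGroup E] [InnerProductSpace ℂ E]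
    [FiniteDimensional ℂ E] [MeasurableSpace E] [BorelSpace E]
    [NormedAddCommGroup F] [InnerProductSpace ℝ F] [FiniteDimensional ℝ F] [MeasurableSpace F]
    [BorelSpace F] : Measure (E × F) :=
  letI : InnerProductSpace ℝ E := InnerProductSpace.rclikeToReal ℂ E
  (volume : Measure E).prod (volume : Measure F)

variable [FiniteDimensional ℂ E] [MeasurableSpace E] [BorelSpace E]
  [FiniteDimensional ℝ F] [MeasurableSpace F] [BorelSpace F]

/-- The entire functions `f` of exponential type `K` with `f_0 ∈ L^p(𝒩)`, as a vector space. -/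
def bernsteinSubmodule (Φ : HermitianMap E F) (p : ℝ≥0∞) (K : Set (StrongDual ℝ F)) :
    Submodule ℂ C(E × Cplx F, ℂ) where
  carrier := {f | f ∈ Hol E F ∧ Φ.ExpType K f ∧ MemLp (Φ.restr f 0) p (lebesgue E F)}
  add_mem' hf hg := ⟨add_mem hf.1 hg.1, hf.2.1.add hg.2.1, hf.2.2.add hg.2.2⟩
  zero_mem' := ⟨zero_mem _, HermitianMap.ExpType.zero Φ K, MemLp.zero⟩
  smul_mem' c _ hf := ⟨Submodule.smul_mem _ c hf.1, hf.2.1.smul c, hf.2.2.const_smul c⟩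

/-- The Bernstein space `ℬ^p_K(𝒩)`, as a vector space that carries no topology but the one
defined by its quasi-norm. -/
def BernsteinSpace (Φ : HermitianMap E F) (p : ℝ≥0∞) (K : Set (StrongDual ℝ F)) : Type _ :=
  ↥(bernsteinSubmodule Φ p K)

namespace BernsteinSpace

variable (Φ : HermitianMap E F) (p : ℝ≥0∞) (K : Set (StrongDual ℝ F))

instance : AddCommGroup (BernsteinSpace Φ p K) :=
  inferInstanceAs (AddCommGroup ↥(bernsteinSubmodule Φ p K))

instance : Module ℂ (BernsteinSpace Φ p K) :=
  inferInstanceAs (Module ℂ ↥(bernsteinSubmodule Φ p K))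

/-- The inclusion of `ℬ^p_K(𝒩)` in `Hol(E × F_ℂ)`. -/
def incl : BernsteinSpace Φ p K →ₗ[ℂ] Hol E F where
  toFun f := ⟨f.1, f.2.1⟩
  map_add' _ _ := rfl
  map_smul' _ _ := rfl

/-- `‖f‖ = ‖f_0‖_{L^p(𝒩)}`. -/
instance : Norm (BernsteinSpace Φ p K) where
  norm f := (eLpNorm (Φ.restr (incl Φ p K f).1 0) p (lebesgue E F)).toReal

end BernsteinSpace

end Bernstein

end

/-! Everything rests on one estimate: `|f(ζ, z)| ≤ C ‖f‖ exp(H_K(ρ(ζ, z)))` for all `f` in the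
space, with `C` independent of `f` (`exists_norm_apply_le`). It bounds point evaluations locally
uniformly, so the quasi-norm is definite and the inclusion in `Hol` is continuous. A Cauchy sequence
then converges locally uniformly to an entire `g`. The estimate involves `K` itself, without `ε`,
and passes to the limit, so `g` has type `K`; Fatou's lemma gives `g_0 ∈ L^p` and convergence in the
quasi-norm.

The estimate combines two facts. The first is a Phragmén-Lindelöf principle on the complex lines `w
↦ f(ζ, x + iΦ(ζ) + wh)`: real `w` stay in `𝒩`, `w = i` gives `f_h`, and the type along the imaginary
axis is at most `H_K(h)`. Applied to `|f|` it yields `sup |f_h| ≤ e^{H_K(h)} sup |f_0|` on each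
fibre; applied to the integral of `|f|^p` over a family of parallel lines it yields the
Plancherel-Pólya inequality `‖f_h‖_p ≤ e^{H_K(h)} ‖f_0‖_p`. The class `LogSubharmonic` covers both
cases, being stable under such integrals and under multiplication by `exp (Re k)`.

The second fact, for `p < ∞`, is the sub-mean value inequality for `|f|^p` on a ball around a point
of `𝒩`. By Tonelli, the integral over the ball is at most an integral over bounded `h` of
`‖f_h‖_p^p`, hence at most a constant times `‖f_0‖_p^p` (`exists_enorm_restr_rpow_le`).

Bounds on `H_K` are stated as "for every real `a ≥ H_K(h)`". This includes `K = ∅`, where `a → -∞`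
forces `f = 0`. -/

/-! ### Sub-mean value inequalities on discs and the maximum principle -/

/-- The circle average of a continuous function `≤ m` that is somewhere `< m` is `< m`. -/
theorem circleAverage_lt_of_le_of_exists_lt {v : ℂ → ℝ} {c : ℂ} {r m : ℝ} (hr : 0 < r)
    (hv : ContinuousOn v (Metric.sphere c r)) (hle : ∀ y ∈ Metric.sphere c r, v y ≤ m)
    (hlt : ∃ y ∈ Metric.sphere c r, v y < m) : Real.circleAverage v c r < m := by
  have hmem : ∀ θ, circleMap c r θ ∈ Metric.sphere c r := circleMap_mem_sphere c hr.le
  have hc : Continuous fun θ : ℝ => v (circleMap c r θ) :=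
    hv.comp_continuous (continuous_circleMap c r) hmem
  obtain ⟨y, hy, hym⟩ := hlt
  obtain ⟨θ, hθ, rfl⟩ : y ∈ circleMap c r '' Ioc 0 (2 * Real.pi) := by
    rwa [image_circleMap_Ioc, abs_of_pos hr]
  have hint : ∫ θ in (0 : ℝ)..2 * Real.pi, v (circleMap c r θ) <
      ∫ _ in (0 : ℝ)..2 * Real.pi, m := by
    refine intervalIntegral.integral_lt_integral_of_continuousOn_of_le_of_exists_lt
      Real.two_pi_pos hc.continuousOn continuousOn_const (fun x _ => hle _ (hmem x))
      ⟨θ, Ioc_subset_Icc_self hθ, hym⟩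
  rw [Real.circleAverage_def, smul_eq_mul]
  rw [intervalIntegral.integral_const, smul_eq_mul, sub_zero] at hint
  rw [inv_mul_lt_iff₀ Real.two_pi_pos]
  exact hint

/-- A maximum principle for functions that satisfy the sub-mean value inequality on one circle
around each point of `D`. -/
theorem IsCompact.le_of_forall_le_circleAverage {K D : Set ℂ} (hK : IsCompact K) {v : ℂ → ℝ}
    (hv : ContinuousOn v K) {M : ℝ}
    (hD : ∀ c ∈ K ∩ D, ∃ r > 0, Metric.closedBall c r ⊆ K ∧ v c ≤ Real.circleAverage v c r)
    (hM : ∀ y ∈ K \ D, v y ≤ M) : ∀ z ∈ K, v z ≤ M := by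
  intro z hz
  obtain ⟨z₀, hz₀, hmax⟩ := hK.exists_isMaxOn ⟨z, hz⟩ hv
  refine (hmax hz).trans ?_
  by_contra! hlt
  -- Among the maximum points, take one with largest real part: the point `c + r` of the circle
  -- around it is then not a maximum point, so the inequality of averages is strict.
  have hS : IsCompact (K ∩ v ⁻¹' {v z₀}) :=
    hK.of_isClosed_subset (hv.preimage_isClosed_of_isClosed hK.isClosed isClosed_singleton)
      inter_subset_left
  obtain ⟨c, ⟨hcK, hcv⟩, hcmax⟩ := hS.exists_isMaxOn ⟨z₀, hz₀, rfl⟩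
    Complex.continuous_re.continuousOn
  have hcv : v c = v z₀ := hcv
  have hcD : c ∈ D := by
    by_contra h
    exact absurd (hM c ⟨hcK, h⟩) (by rw [hcv]; exact not_le.2 hlt)
  obtain ⟨r, hr, hrK, hle⟩ := hD c ⟨hcK, hcD⟩
  have hsK : Metric.sphere c r ⊆ K := Metric.sphere_subset_closedBall.trans hrK
  have hmem : c + r ∈ Metric.sphere c r := by simp [abs_of_pos hr]
  refine absurd hle (not_le.2 ?_)
  rw [hcv]
  refine circleAverage_lt_of_le_of_exists_lt hr (hv.mono hsK) (fun y hy => hmax (hsK hy))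
    ⟨c + r, hmem, lt_of_le_of_ne (hmax (hsK hmem)) fun h => ?_⟩
  have h2 : (c + r).re ≤ c.re := hcmax ⟨hsK hmem, h⟩
  simp at h2
  linarith

/-- For `H` analytic on a closed disc and `p > 0`, `‖H‖ ^ p` satisfies the sub-mean value
inequality. -/
theorem AnalyticOnNhd.norm_rpow_le_circleAverage {H : ℂ → ℂ} {c : ℂ} {r p : ℝ} (hr : 0 < r)
    (hp : 0 < p) (hH : AnalyticOnNhd ℂ H (Metric.closedBall c r)) :
    ‖H c‖ ^ p ≤ Real.circleAverage (fun w => ‖H w‖ ^ p) c r := by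
  have hcont : ContinuousOn (fun w => ‖H w‖ ^ p) (Metric.sphere c r) :=
    ((hH.continuousOn.norm).rpow_const fun _ _ => Or.inr hp.le).mono
      Metric.sphere_subset_closedBall
  by_cases h0 : H c = 0
  · rw [h0, norm_zero, Real.zero_rpow hp.ne']
    exact Real.circleAverage_nonneg_of_nonneg fun _ _ => by positivity
  have hH' : AnalyticOnNhd ℂ H (Metric.closedBall c |r|) := by rwa [abs_of_pos hr]
  -- Jensen's formula: the zeros in the disc contribute nonnegative terms.
  have hlog : Real.log ‖H c‖ ≤ Real.circleAverage (fun w => Real.log ‖H w‖) c r := by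
    rw [hH'.circleAverage_log_norm hr.ne' h0, le_add_iff_nonneg_left]
    refine finsum_nonneg fun u => ?_
    by_cases hu : u ∈ Metric.closedBall c |r|
    · refine mul_nonneg ?_ ?_
      · exact mod_cast MeromorphicOn.AnalyticOnNhd.divisor_nonneg hH' u
      · rcases eq_or_ne u c with rfl | huc
        · simp
        · refine Real.log_nonneg ?_
          have h1 : 0 < ‖c - u‖ := norm_pos_iff.2 (sub_ne_zero.2 huc.symm)
          rw [← div_eq_mul_inv, one_le_div h1]
          rw [Metric.mem_closedBall, abs_of_pos hr, dist_comm, dist_eq_norm] at hu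
          exact hu
    · rw [Function.locallyFinsuppWithin.apply_eq_zero_of_notMem _ hu]
      simp
  set a := ‖H c‖
  have ha0 : 0 < a := norm_pos_iff.2 h0
  have hint : CircleIntegrable (fun w => Real.log ‖H w‖) c r :=
    (hH'.mono Metric.sphere_subset_closedBall).meromorphicOn.circleIntegrable_log_norm
  -- the tangent line inequality, off the zeros
  have htan : ∀ t : ℝ, 0 < t → a ^ p * (1 + p * (Real.log t - Real.log a)) ≤ t ^ p := by
    intro t ht
    have h1 := Real.add_one_le_exp (p * (Real.log t - Real.log a))
    have h2 : t ^ p = a ^ p * Real.exp (p * (Real.log t - Real.log a)) := by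
      rw [Real.rpow_def_of_pos ht, Real.rpow_def_of_pos ha0, ← Real.exp_add]
      ring_nf
    rw [h2]
    gcongr
    linarith
  have hne : ∀ᶠ w in Filter.codiscreteWithin (Metric.sphere c |r|), H w ≠ 0 := by
    refine Filter.codiscreteWithin_mono Metric.sphere_subset_closedBall
      ((hH'.eqOn_zero_or_eventually_ne_zero_of_preconnected
        (convex_closedBall c |r|).isPreconnected).resolve_left fun h => h0 (h ?_))
    simp
  classical
  let T : ℂ → ℝ := fun w => a ^ p * (1 + p * (Real.log ‖H w‖ - Real.log a))
  -- At a zero of `H` the convention `Real.log 0 = 0` may make `T` larger than `‖H w‖ ^ p = 0`.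
  -- Since zeros are isolated, changing the values there does not affect the average.
  let s : ℂ → ℝ := fun w => if H w = 0 then T w else ‖H w‖ ^ p
  have hs : s =ᶠ[Filter.codiscreteWithin (Metric.sphere c |r|)] fun w => ‖H w‖ ^ p := by
    filter_upwards [hne] with w hw
    simp [s, hw]
  have hsint : CircleIntegrable s c r :=
    (hcont.circleIntegrable hr.le).congr_codiscreteWithin hs.symm
  have hTeq : T = (fun _ => a ^ p * (1 - p * Real.log a)) +
      (a ^ p * p) • fun w => Real.log ‖H w‖ := by
    funext w
    simp only [T, Pi.add_apply, Pi.smul_apply, smul_eq_mul]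
    ring
  have hcint : CircleIntegrable (fun _ => a ^ p * (1 - p * Real.log a)) c r :=
    circleIntegrable_const _ _ _
  have hT2 : CircleIntegrable ((a ^ p * p) • fun w => Real.log ‖H w‖) c r := hint.const_smul
  calc a ^ p ≤ Real.circleAverage T c r := by
        rw [hTeq, Real.circleAverage_add hcint hT2, Real.circleAverage_smul,
          Real.circleAverage_const, smul_eq_mul]
        have h3 : 0 ≤ a ^ p * p := by positivity
        nlinarith [mul_le_mul_of_nonneg_left hlog h3]
    _ ≤ Real.circleAverage s c r := by
        refine Real.circleAverage_mono (hTeq ▸ hcint.add hT2) hsint fun w _ => ?_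
        by_cases hw : H w = 0
        · simp [s, hw]
        · simp only [s, hw, if_false]
          exact htan _ (norm_pos_iff.2 hw)
    _ = _ := Real.circleAverage_congr_codiscreteWithin hs hr.ne'

/-! ### Log-subharmonic functions and the Phragmén-Lindelöf principle -/

/-- Continuous nonnegative functions `u` on the plane such that `exp (Re k) * u` satisfies the
sub-mean value inequality for all analytic `k`; for `u > 0` this says that `log u` is
subharmonic. -/
structure LogSubharmonic (u : ℂ → ℝ) : Prop where
  continuous : Continuous u
  nonneg : ∀ w, 0 ≤ u w
  submean : ∀ (k : ℂ → ℂ) (c : ℂ) (r : ℝ), 0 < r → AnalyticOnNhd ℂ k (Metric.closedBall c r) →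
    Real.exp (k c).re * u c ≤ Real.circleAverage (fun w => Real.exp (k w).re * u w) c r

namespace LogSubharmonic

variable {u : ℂ → ℝ}

/-- The multiplier is absorbed into the analytic function: `exp (Re k) |G|^p = |exp (k / p) G|^p`.
-/
theorem of_norm_rpow {G : ℂ → ℂ} (hG : Differentiable ℂ G) {p : ℝ} (hp : 0 < p) :
    LogSubharmonic fun w => ‖G w‖ ^ p where
  continuous := hG.continuous.norm.rpow_const fun _ => Or.inr hp.le
  nonneg _ := by positivity
  submean k c r hr hk := by
    have h1 : AnalyticOnNhd ℂ (fun w => Complex.exp (k w / p) * G w) (Metric.closedBall c r) := by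
      intro w hw
      refine AnalyticAt.mul ?_ (hG.analyticAt w)
      exact ((hk w hw).div analyticAt_const (by exact_mod_cast hp.ne')).cexp
    have h2 : ∀ w, ‖Complex.exp (k w / p) * G w‖ ^ p = Real.exp (k w).re * ‖G w‖ ^ p := by
      intro w
      rw [norm_mul, Real.mul_rpow (norm_nonneg _) (norm_nonneg _), Complex.norm_exp,
        ← Real.exp_mul, Complex.div_ofReal_re, div_mul_cancel₀ _ hp.ne']
    have h3 := h1.norm_rpow_le_circleAverage hr hp
    simpa only [h2] using h3

theorem le_circleAverage (hu : LogSubharmonic u) (c : ℂ) {r : ℝ} (hr : 0 < r) :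
    u c ≤ Real.circleAverage u c r := by
  simpa using hu.submean (fun _ => 0) c r hr (fun _ _ => analyticAt_const)

/-- Multipliers compose by adding exponents, which is why the definition quantifies over all `k`.
There `k` need only be analytic on the disc, so that the power of order `3/2` used in a quadrant is
admissible. -/
theorem exp_mul (hu : LogSubharmonic u) {k : ℂ → ℂ} (hk : Differentiable ℂ k) :
    LogSubharmonic fun w => Real.exp (k w).re * u w where
  continuous := (Real.continuous_exp.comp (Complex.continuous_re.comp hk.continuous)).mul
    hu.continuous
  nonneg w := mul_nonneg (Real.exp_pos _).le (hu.nonneg w)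
  submean l c r hr hl := by
    have h := hu.submean (fun w => l w + k w) c r hr fun w hw => (hl w hw).add (hk.analyticAt w)
    simpa only [Complex.add_re, Real.exp_add, mul_assoc] using h

/-- The Phragmén-Lindelöf principle in a closed quadrant `{0 ≤ Re (σw), 0 ≤ Im (σw)}`. -/
theorem le_of_quadrant (hu : LogSubharmonic u) {σ : ℂ} (hσ : ‖σ‖ = 1) {C M : ℝ} (hM : 0 < M)
    (hgrowth : ∀ w, 0 ≤ (σ * w).re → 0 ≤ (σ * w).im → u w ≤ C * Real.exp (C * ‖w‖))
    (hre : ∀ w, 0 ≤ (σ * w).re → (σ * w).im = 0 → u w ≤ M)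
    (him : ∀ w, (σ * w).re = 0 → 0 ≤ (σ * w).im → u w ≤ M) :
    ∀ w, 0 ≤ (σ * w).re → 0 ≤ (σ * w).im → u w ≤ M := by
  intro w₀ hw₀ hw₀'
  -- `k = (e^{-iπ/4} ζ)^{3/2}`: the exponent exceeds the order `1` of growth and is below `2`, the
  -- critical order of a quadrant. The shift by `1 + i` keeps the branch point off the closed
  -- quadrant. As `arg ζ` is within `π/4` of `π/4`, the argument of `k` is at most `3π/8` in
  -- absolute value, whence the constant `b`.
  let ζ : ℂ → ℂ := fun w => σ * w + (1 + Complex.I)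
  let k : ℂ → ℂ := fun w => Complex.exp (3 / 2 * (Complex.log (ζ w) - Real.pi / 4 * Complex.I))
  have hζre : ∀ w, (ζ w).re = (σ * w).re + 1 := fun w => by simp [ζ]
  have hζim : ∀ w, (ζ w).im = (σ * w).im + 1 := fun w => by simp [ζ]
  set b : ℝ := Real.cos (3 * Real.pi / 8) with hb
  have hb0 : 0 < b := Real.cos_pos_of_mem_Ioo ⟨by linarith [Real.pi_pos], by linarith [Real.pi_pos]⟩
  have hkan : ∀ w, 0 ≤ (σ * w).re → AnalyticAt ℂ k w := by
    intro w hw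
    have hs : ζ w ∈ Complex.slitPlane := Or.inl (by rw [hζre]; linarith)
    have hζan : AnalyticAt ℂ ζ w :=
      (Differentiable.analyticAt (by fun_prop) w)
    exact (analyticAt_const.mul ((hζan.clog hs).sub analyticAt_const)).cexp
  have hkre : ∀ w, 0 ≤ (σ * w).re → 0 ≤ (σ * w).im → b * ‖w‖ ^ (3 / 2 : ℝ) ≤ (k w).re := by
    intro w hw hw'
    have hre : 0 < (ζ w).re := by rw [hζre]; linarith
    have him : 0 < (ζ w).im := by rw [hζim]; linarith
    have hne : ζ w ≠ 0 := fun h => by rw [h] at hre; simp at hre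
    have harg0 : 0 ≤ (ζ w).arg := Complex.arg_nonneg_iff.2 him.le
    have harg1 : (ζ w).arg ≤ Real.pi / 2 := Complex.arg_le_pi_div_two_iff.2 (Or.inl hre.le)
    have hnorm : ‖w‖ ≤ ‖ζ w‖ := by
      have h1 : ‖w‖ = ‖σ * w‖ := by rw [norm_mul, hσ, one_mul]
      rw [h1, ← sq_le_sq₀ (norm_nonneg _) (norm_nonneg _), ← Complex.normSq_eq_norm_sq,
        ← Complex.normSq_eq_norm_sq, Complex.normSq_apply, Complex.normSq_apply, hζre, hζim]
      nlinarith
    have hk : (k w).re = ‖ζ w‖ ^ (3 / 2 : ℝ) *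
        Real.cos (3 / 2 * ((ζ w).arg - Real.pi / 4)) := by
      simp only [k]
      rw [Complex.exp_re]
      have e1 : (3 / 2 * (Complex.log (ζ w) - Real.pi / 4 * Complex.I)).re
          = Real.log ‖ζ w‖ * (3 / 2) := by
        simp [Complex.log_re]
        ring
      have e2 : (3 / 2 * (Complex.log (ζ w) - Real.pi / 4 * Complex.I)).im
          = 3 / 2 * ((ζ w).arg - Real.pi / 4) := by
        simp [Complex.log_im]
      rw [e1, e2, Real.rpow_def_of_pos (norm_pos_iff.2 hne)]
    rw [hk, mul_comm b]
    have hcos : b ≤ Real.cos (3 / 2 * ((ζ w).arg - Real.pi / 4)) := by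
      rw [hb, ← Real.cos_abs (3 / 2 * _)]
      refine Real.cos_le_cos_of_nonneg_of_le_pi (abs_nonneg _) (by linarith [Real.pi_pos]) ?_
      rw [abs_le]
      constructor <;> linarith
    gcongr
  have hkpos : ∀ w, 0 ≤ (σ * w).re → 0 ≤ (σ * w).im → 0 ≤ (k w).re := fun w hw hw' =>
    (by positivity : (0 : ℝ) ≤ b * ‖w‖ ^ (3 / 2 : ℝ)).trans (hkre w hw hw')
  have hmain : ∀ ε : ℝ, 0 < ε → Real.exp (-ε * (k w₀).re) * u w₀ ≤ M := by
    intro ε hε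
    let v : ℂ → ℝ := fun w => Real.exp ((-(ε : ℂ) * k w).re) * u w
    have hv : ∀ w, v w = Real.exp (-ε * (k w).re) * u w := fun w => by simp [v]
    have hlim : Filter.Tendsto (fun R : ℝ => C * Real.exp (C * R - ε * (b * R ^ (3 / 2 : ℝ))))
        Filter.atTop (𝓝 0) := by
      have h1 : Filter.Tendsto (fun R : ℝ => C - ε * b * R ^ (1 / 2 : ℝ)) Filter.atTop
          Filter.atBot := by
        have := (tendsto_rpow_atTop (y := 1 / 2) (by norm_num)).const_mul_atTop (mul_pos hε hb0)
        simpa only [sub_eq_add_neg, Function.comp_def] using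
          Filter.tendsto_atBot_add_const_left _ C (Filter.tendsto_neg_atTop_atBot.comp this)
      have h2 : Filter.Tendsto (fun R : ℝ => C * R - ε * (b * R ^ (3 / 2 : ℝ))) Filter.atTop
          Filter.atBot := by
        refine (Filter.tendsto_id.atTop_mul_atBot₀ h1).congr' ?_
        filter_upwards [Filter.eventually_gt_atTop 0] with R hR
        rw [show (3 / 2 : ℝ) = 1 + 1 / 2 by norm_num, Real.rpow_add hR, Real.rpow_one]
        simp only [id]
        ring
      simpa using (Real.tendsto_exp_atBot.comp h2).const_mul C
    obtain ⟨R, hR, hRw⟩ : ∃ R : ℝ, C * Real.exp (C * R - ε * (b * R ^ (3 / 2 : ℝ))) ≤ M ∧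
        ‖w₀‖ ≤ R :=
      (((hlim.eventually (gt_mem_nhds hM)).mono fun _ h => le_of_lt h).and
        (Filter.eventually_ge_atTop ‖w₀‖)).exists
    let Q : Set ℂ := {w | 0 ≤ (σ * w).re ∧ 0 ≤ (σ * w).im}
    let D : Set ℂ := {w | 0 < (σ * w).re ∧ 0 < (σ * w).im}
    have hcre : Continuous fun w : ℂ => (σ * w).re := by fun_prop
    have hcim : Continuous fun w : ℂ => (σ * w).im := by fun_prop
    have hQ : IsClosed Q :=
      (isClosed_le continuous_const hcre).inter (isClosed_le continuous_const hcim)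
    have hD : IsOpen D :=
      (isOpen_lt continuous_const hcre).inter (isOpen_lt continuous_const hcim)
    have hDQ : D ⊆ Q := fun w hw => ⟨hw.1.le, hw.2.le⟩
    have hK : IsCompact (Metric.closedBall (0 : ℂ) R ∩ Q) :=
      (isCompact_closedBall _ _).inter_right hQ
    rw [← hv]
    refine hK.le_of_forall_le_circleAverage (D := Metric.ball (0 : ℂ) R ∩ D) (v := v) ?_ ?_ ?_ w₀
      ⟨by simpa using hRw, hw₀, hw₀'⟩
    · intro w hw
      have hkc := (hkan w hw.2.1).continuousAt
      have huc := hu.continuous.continuousAt (x := w)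
      have : ContinuousAt v w :=
        (Real.continuous_exp.continuousAt.comp
          (Complex.continuous_re.continuousAt.comp (continuousAt_const.mul hkc))).mul huc
      exact this.continuousWithinAt
    · rintro c ⟨-, hc⟩
      obtain ⟨r, hr, hrs⟩ := Metric.nhds_basis_closedBall.mem_iff.1
        ((Metric.isOpen_ball.inter hD).mem_nhds hc)
      refine ⟨r, hr, fun y hy => ⟨Metric.ball_subset_closedBall (hrs hy).1, hDQ (hrs hy).2⟩, ?_⟩
      exact hu.submean (fun w => -(ε : ℂ) * k w) c r hr fun w hw =>
        analyticAt_const.mul (hkan w (hrs hw).2.1.le)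
    · rintro y ⟨⟨hy1, hy2, hy3⟩, hyD⟩
      rw [hv]
      have hexp : Real.exp (-ε * (k y).re) ≤ 1 :=
        Real.exp_le_one_iff.2 (by nlinarith [hkpos y hy2 hy3])
      have hle : Real.exp (-ε * (k y).re) * u y ≤ u y := mul_le_of_le_one_left (hu.nonneg y) hexp
      by_cases hyR : ‖y‖ < R
      · rcases hy2.eq_or_lt with h2 | h2
        · exact hle.trans (him y h2.symm hy3)
        rcases hy3.eq_or_lt with h3 | h3
        · exact hle.trans (hre y h2.le h3.symm)
        exact absurd ⟨by simpa using hyR, h2, h3⟩ hyD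
      · have hyR' : ‖y‖ = R := le_antisymm (by simpa using hy1) (not_lt.1 hyR)
        refine le_trans ?_ hR
        calc Real.exp (-ε * (k y).re) * u y
            ≤ Real.exp (-ε * (b * R ^ (3 / 2 : ℝ))) * (C * Real.exp (C * R)) := by
              have h1 := hkre y hy2 hy3
              rw [hyR'] at h1
              have h2 := hgrowth y hy2 hy3
              rw [hyR'] at h2
              refine mul_le_mul (Real.exp_le_exp.2 ?_) h2 (hu.nonneg y) (Real.exp_pos _).le
              nlinarith
          _ = _ := by
              rw [sub_eq_add_neg, Real.exp_add]
              ring_nf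
  have ht : Filter.Tendsto (fun ε : ℝ => Real.exp (-ε * (k w₀).re) * u w₀) (𝓝[>] 0)
      (𝓝 (Real.exp (-0 * (k w₀).re) * u w₀)) :=
    (Continuous.tendsto (by fun_prop) 0).mono_left nhdsWithin_le_nhds
  have := le_of_tendsto ht (Filter.eventually_of_mem self_mem_nhdsWithin hmain)
  simpa using this

/-- The Phragmén-Lindelöf principle in the upper half-plane, for functions that tend to `0` along
the imaginary axis. -/
theorem le_of_upperHalfPlane (hu : LogSubharmonic u) {C M : ℝ} (hM : 0 < M)
    (hgrowth : ∀ w : ℂ, 0 ≤ w.im → u w ≤ C * Real.exp (C * ‖w‖))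
    (hreal : ∀ x : ℝ, u x ≤ M)
    (him : Filter.Tendsto (fun t : ℝ => u (t * Complex.I)) Filter.atTop (𝓝 0)) :
    ∀ w : ℂ, 0 ≤ w.im → u w ≤ M := by
  have hcont : Continuous fun t : ℝ => u (t * Complex.I) := hu.continuous.comp (by fun_prop)
  by_contra! hex
  obtain ⟨w₁, hw₁, hlt⟩ := hex
  -- a bound by `m` on the imaginary axis propagates to the half-plane
  have hprop : ∀ m : ℝ, M ≤ m → (∀ t : ℝ, 0 ≤ t → u (t * Complex.I) ≤ m) →
      ∀ w : ℂ, 0 ≤ w.im → u w ≤ m := by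
    intro m hm hmi w hw
    have hreal' : ∀ w : ℂ, w.im = 0 → u w ≤ m := fun w hw => by
      rw [show w = (w.re : ℂ) from Complex.ext rfl (by simpa using hw)]
      exact (hreal _).trans hm
    have himag' : ∀ w : ℂ, w.re = 0 → 0 ≤ w.im → u w ≤ m := fun w hw hw' => by
      rw [show w = (w.im : ℂ) * Complex.I from Complex.ext (by simpa using hw) (by simp)]
      exact hmi _ hw'
    rcases le_total 0 w.re with h | h
    · exact hu.le_of_quadrant (σ := 1) (by simp) (hM.trans_le hm)
        (fun w _ h2 => hgrowth w (by simpa using h2)) (fun w _ h2 => hreal' w (by simpa using h2))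
        (fun w h1 h2 => himag' w (by simpa using h1) (by simpa using h2)) w (by simpa using h)
        (by simpa using hw)
    · exact hu.le_of_quadrant (σ := -Complex.I) (by simp) (hM.trans_le hm)
        (fun w h1 _ => hgrowth w (by simpa using h1))
        (fun w h1 h2 => himag' w (by simpa using h2) (by simpa using h1))
        (fun w h1 _ => hreal' w (by simpa using h1)) w (by simpa using hw) (by simpa using h)
  -- If `u` exceeds `M` somewhere on the imaginary axis, its maximum there is attained, since `u`
  -- tends to `0`; by `hprop` it is then the maximum over the half-plane.
  obtain ⟨t₁, ht₁, hlt₁⟩ : ∃ t : ℝ, 0 ≤ t ∧ M < u (t * Complex.I) := by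
    by_contra! h
    exact absurd (hprop M le_rfl h w₁ hw₁) (not_le.2 hlt)
  obtain ⟨T, hT⟩ := Filter.eventually_atTop.1 (him.eventually (gt_mem_nhds hM))
  obtain ⟨t₀, ht₀, hmax⟩ := (isCompact_Icc (a := (0 : ℝ)) (b := max t₁ T)).exists_isMaxOn
    ⟨t₁, ht₁, le_max_left _ _⟩ hcont.continuousOn
  have hm : M < u (t₀ * Complex.I) := hlt₁.trans_le (hmax ⟨ht₁, le_max_left _ _⟩)
  have hall := hprop _ hm.le fun t ht => by
    by_cases h : t ≤ max t₁ T
    · exact hmax ⟨ht, h⟩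
    · exact ((hT t ((le_max_right _ _).trans (not_le.1 h).le)).trans hm).le
  have hu0 : u 0 ≤ M := by simpa using hreal 0
  have ht₀pos : 0 < t₀ := by
    refine lt_of_le_of_ne ht₀.1 fun h => ?_
    rw [← h] at hm
    simp only [Complex.ofReal_zero, zero_mul] at hm
    exact absurd hu0 (not_le.2 hm)
  -- The circle of radius `t₀` about `i t₀` lies in the closed half-plane and touches the real axis
  -- at `0`, where `u ≤ M` is strictly below the maximum.
  refine absurd (hu.le_circleAverage (t₀ * Complex.I) ht₀pos) (not_le.2 ?_)
  refine circleAverage_lt_of_le_of_exists_lt ht₀pos hu.continuous.continuousOn (fun y hy => ?_)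
    ⟨0, by simp [abs_of_pos ht₀pos], hu0.trans_lt hm⟩
  refine hall y ?_
  have h1 : |(y - t₀ * Complex.I).im| ≤ t₀ := by
    refine (Complex.abs_im_le_norm _).trans ?_
    rw [Metric.mem_sphere, dist_eq_norm] at hy
    exact hy.le
  have h2 := (abs_le.1 h1).1
  simp at h2
  linarith

/-- The Phragmén-Lindelöf principle in the upper half-plane for functions of exponential growth,
with control of the type along the imaginary axis. -/
theorem le_mul_exp (hu : LogSubharmonic u) {C M a : ℝ} (hM : 0 ≤ M)
    (hgrowth : ∀ w : ℂ, 0 ≤ w.im → u w ≤ C * Real.exp (C * ‖w‖))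
    (hreal : ∀ x : ℝ, u x ≤ M)
    (him : ∀ a' > a, ∃ C' : ℝ, ∀ t : ℝ, 0 ≤ t → u (t * Complex.I) ≤ C' * Real.exp (a' * t))
    (w : ℂ) (hw : 0 ≤ w.im) : u w ≤ M * Real.exp (a * w.im) := by
  have key : ∀ δ > 0, u w ≤ (M + δ) * Real.exp ((a + δ) * w.im) := by
    intro δ hδ
    -- The multiplier has modulus `1` on the real axis, and `exp (-(a + δ) t)` beats the type `a + δ
    -- / 2` on the imaginary axis. Adding `δ` to `M` makes the bound positive.
    let k : ℂ → ℂ := fun w => (a + δ : ℝ) * Complex.I * w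
    have hkre : ∀ w, (k w).re = -((a + δ) * w.im) := fun w => by simp [k]
    have hv := hu.exp_mul (k := k) (by fun_prop)
    have h := hv.le_of_upperHalfPlane (C := C + |a + δ|) (M := M + δ) (by positivity)
      ?_ ?_ ?_ w hw
    · rw [hkre, Real.exp_neg, inv_mul_le_iff₀ (Real.exp_pos _)] at h
      linarith
    · intro w hw
      rw [hkre]
      calc Real.exp (-((a + δ) * w.im)) * u w
          ≤ Real.exp (|a + δ| * ‖w‖) * (C * Real.exp (C * ‖w‖)) := by
            refine mul_le_mul (Real.exp_le_exp.2 ?_) (hgrowth w hw) (hu.nonneg w)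
              (Real.exp_pos _).le
            calc -((a + δ) * w.im) ≤ |(a + δ) * w.im| := neg_le_abs _
              _ = |a + δ| * |w.im| := abs_mul _ _
              _ ≤ _ := by gcongr; exact Complex.abs_im_le_norm w
        _ = C * Real.exp ((C + |a + δ|) * ‖w‖) := by rw [add_mul, Real.exp_add]; ring
        _ ≤ _ := by gcongr; linarith [abs_nonneg (a + δ)]
    · intro x
      rw [hkre]
      simpa using (hreal x).trans (by linarith)
    · obtain ⟨C', hC'⟩ := him (a + δ / 2) (by linarith)
      have hlim : Filter.Tendsto (fun t : ℝ => C' * Real.exp (-(δ / 2 * t))) Filter.atTop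
          (𝓝 0) := by
        have := (Filter.tendsto_id.const_mul_atTop (half_pos hδ) : Filter.Tendsto
          (fun t : ℝ => δ / 2 * t) Filter.atTop Filter.atTop)
        simpa using (Real.tendsto_exp_neg_atTop_nhds_zero.comp this).const_mul C'
      refine squeeze_zero' (Filter.Eventually.of_forall fun t => hv.nonneg _) ?_ hlim
      filter_upwards [Filter.eventually_ge_atTop 0] with t ht
      rw [hkre]
      calc Real.exp (-((a + δ) * ((t : ℂ) * Complex.I).im)) * u (t * Complex.I)
          ≤ Real.exp (-((a + δ) * t)) * (C' * Real.exp ((a + δ / 2) * t)) := by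
            have : ((t : ℂ) * Complex.I).im = t := by simp
            rw [this]
            gcongr
            exact hC' t ht
        _ = C' * Real.exp (-(δ / 2 * t)) := by
            rw [mul_left_comm, ← Real.exp_add]
            ring_nf
  have ht : Filter.Tendsto (fun δ : ℝ => (M + δ) * Real.exp ((a + δ) * w.im)) (𝓝[>] 0)
      (𝓝 ((M + 0) * Real.exp ((a + 0) * w.im))) :=
    (Continuous.tendsto (by fun_prop) 0).mono_left nhdsWithin_le_nhds
  have := ge_of_tendsto ht (Filter.eventually_of_mem self_mem_nhdsWithin key)
  simpa using this

/-- A form of `LogSubharmonic.le_mul_exp` with a single growth hypothesis. -/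
theorem le_mul_exp_of_growth (hu : LogSubharmonic u) {M a : ℝ} (hM : 0 ≤ M)
    (hgrowth : ∀ ε > 0, ∃ C > 0, ∀ w : ℂ, 0 ≤ w.im →
      u w ≤ C * Real.exp (C * |w.re| + (a + ε) * w.im))
    (hreal : ∀ x : ℝ, u x ≤ M) (w : ℂ) (hw : 0 ≤ w.im) : u w ≤ M * Real.exp (a * w.im) := by
  obtain ⟨C, hC, hCu⟩ := hgrowth 1 one_pos
  refine hu.le_mul_exp (C := C + |a + 1|) hM (fun w hw => ?_) hreal
    (fun a' ha' => ?_) w hw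
  · refine (hCu w hw).trans ?_
    have h1 : (a + 1) * w.im ≤ |a + 1| * ‖w‖ := by
      refine (le_abs_self _).trans ?_
      rw [abs_mul]
      gcongr
      exact Complex.abs_im_le_norm w
    have h2 : C * |w.re| ≤ C * ‖w‖ := by gcongr; exact Complex.abs_re_le_norm w
    have h3 : C ≤ C + |a + 1| := le_add_of_nonneg_right (abs_nonneg _)
    refine mul_le_mul h3 (Real.exp_le_exp.2 ?_) (Real.exp_pos _).le (by positivity)
    rw [add_mul]
    linarith
  · obtain ⟨C', -, h⟩ := hgrowth (a' - a) (by linarith)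
    exact ⟨C', fun t ht => by simpa using h (t * Complex.I) (by simpa using ht)⟩

/-- The integral of a family of functions `‖G‖ ^ p`, with `G` entire, over a compact set. -/
theorem setIntegral_norm_rpow {X : Type*} [TopologicalSpace X] [MeasurableSpace X]
    [OpensMeasurableSpace X] [SecondCountableTopology X] [T2Space X]
    {μ : Measure X} [IsLocallyFiniteMeasure μ] [SFinite μ]
    {B : Set X} (hB : IsCompact B) {G : X → ℂ → ℂ} (hGc : Continuous fun q : X × ℂ => G q.1 q.2)
    (hG : ∀ ξ, Differentiable ℂ (G ξ)) {p : ℝ} (hp : 0 < p) :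
    LogSubharmonic fun w => ∫ ξ in B, ‖G ξ w‖ ^ p ∂μ := by
  have hcp : Continuous fun q : X × ℂ => ‖G q.1 q.2‖ ^ p :=
    hGc.norm.rpow_const fun _ => Or.inr hp.le
  have hcw : ∀ w, Continuous fun ξ : X => ‖G ξ w‖ ^ p := fun w =>
    hcp.comp (continuous_id.prodMk continuous_const)
  have hcont : Continuous fun w => ∫ ξ in B, ‖G ξ w‖ ^ p ∂μ :=
    continuous_parametric_integral_of_continuous (f := fun w ξ => ‖G ξ w‖ ^ p)
      (hcp.comp continuous_swap) hB
  refine ⟨hcont, fun w => integral_nonneg fun ξ => by positivity, fun k c r hr hk => ?_⟩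
  have hmem : ∀ θ, circleMap c r θ ∈ Metric.closedBall c r := circleMap_mem_closedBall c hr.le
  have hkc : Continuous fun θ : ℝ => k (circleMap c r θ) :=
    hk.continuousOn.comp_continuous (continuous_circleMap c r) hmem
  have hFc : Continuous fun q : X × ℝ =>
      Real.exp (k (circleMap c r q.2)).re * ‖G q.1 (circleMap c r q.2)‖ ^ p := by
    refine (Real.continuous_exp.comp (Complex.continuous_re.comp (hkc.comp continuous_snd))).mul
      (hcp.comp (continuous_fst.prodMk ((continuous_circleMap c r).comp continuous_snd)))
  have hFint : Integrable (Function.uncurry fun (ξ : X) (θ : ℝ) =>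
      Real.exp (k (circleMap c r θ)).re * ‖G ξ (circleMap c r θ)‖ ^ p)
      ((μ.restrict B).prod (volume.restrict (Ioc 0 (2 * Real.pi)))) := by
    rw [Measure.prod_restrict]
    exact (hFc.continuousOn.integrableOn_compact (hB.prod isCompact_Icc)).mono_set
      (prod_mono_right Ioc_subset_Icc_self)
  -- By Fubini, the inequality for the integral is the integral of the inequalities for each `ξ`.
  have hswap : Real.circleAverage (fun w => Real.exp (k w).re * ∫ ξ in B, ‖G ξ w‖ ^ p ∂μ) c r =
      ∫ ξ in B, Real.circleAverage (fun w => Real.exp (k w).re * ‖G ξ w‖ ^ p) c r ∂μ := by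
    simp only [Real.circleAverage_def, smul_eq_mul, integral_const_mul]
    congr 1
    simp only [intervalIntegral.integral_of_le Real.two_pi_pos.le, ← integral_const_mul]
    exact (integral_integral_swap hFint).symm
  rw [hswap, ← integral_const_mul]
  refine integral_mono ?_ ?_ fun ξ => (of_norm_rpow (hG ξ) hp).submean k c r hr hk
  · exact (continuous_const.mul (hcw c)).continuousOn.integrableOn_compact hB
  · simp only [Real.circleAverage_def, smul_eq_mul,
      intervalIntegral.integral_of_le Real.two_pi_pos.le]
    exact hFint.integral_prod_left.const_mul _

end LogSubharmonic

/-! ### Supporting functions and restriction to complex lines -/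

section Basics

variable {E F : Type*} [NormedAddCommGroup E] [InnerProductSpace ℂ E]
  [NormedAddCommGroup F] [InnerProductSpace ℝ F]

namespace Cplx

theorem mk_re_im (z : Cplx F) : mk z.re z.im = z := rfl

end Cplx

theorem coe_le_suppFun {K : Set (StrongDual ℝ F)} {l : StrongDual ℝ F} (hl : l ∈ -K) (h : F) :
    ((l h : ℝ) : EReal) ≤ suppFun K h :=
  le_iSup₂ (f := fun (l : StrongDual ℝ F) (_ : l ∈ -K) => ((l h : ℝ) : EReal)) l hl

theorem suppFun_mono {K L : Set (StrongDual ℝ F)} (hKL : K ⊆ L) (h : F) :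
    suppFun K h ≤ suppFun L h :=
  iSup₂_le fun _ hl => coe_le_suppFun (Set.neg_subset_neg.2 hKL hl) h

/-- Enlarging `K` by a ball of radius `ε` adds at most `ε ‖h‖` to `H_K(h)`, and supporting functions
are positively homogeneous. A real bound `a` avoids arithmetic with `-∞`. -/
theorem suppFun_add_closedBall_smul_le {K : Set (StrongDual ℝ F)} {h : F} {a ε t : ℝ}
    (ha : suppFun K h ≤ a) (ht : 0 ≤ t) :
    suppFun (K + Metric.closedBall (0 : StrongDual ℝ F) ε) (t • h) ≤
      (((a + ε * ‖h‖) * t : ℝ) : EReal) := by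
  refine iSup₂_le fun l hl => EReal.coe_le_coe ?_
  obtain ⟨k, hk, b, hb, hkb⟩ := Set.mem_add.1 (Set.mem_neg.1 hl)
  have h1 : (-k) h ≤ a :=
    EReal.coe_le_coe_iff.1 ((coe_le_suppFun (by simpa using hk) h).trans ha)
  have h2 : |b h| ≤ ε * ‖h‖ :=
    b.le_of_opNorm_le (by simpa using hb) h
  have h3 : l h = (-k) h - b h := by
    rw [show l = -(k + b) by rw [hkb, neg_neg]]
    simp
    ring
  rw [map_smul, smul_eq_mul, h3, mul_comm]
  have := neg_abs_le (b h)
  gcongr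
  linarith

theorem suppFun_le_mul_norm {K : Set (StrongDual ℝ F)} {R : ℝ} (hR : ∀ l ∈ K, ‖l‖ ≤ R) (h : F) :
    suppFun K h ≤ ((R * ‖h‖ : ℝ) : EReal) := by
  refine iSup₂_le fun l hl => EReal.coe_le_coe ?_
  have : ‖l‖ ≤ R := by simpa using hR (-l) hl
  exact (le_abs_self _).trans (l.le_of_opNorm_le this h)

namespace HermitianMap

theorem continuous_toFun_left [FiniteDimensional ℂ E] (Φ : HermitianMap E F) (ζ' : E) :
    Continuous fun ζ => Φ.toFun ζ ζ' :=
  LinearMap.continuous_of_finiteDimensional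
    ({ toFun := fun ζ => Φ.toFun ζ ζ', map_add' := by simp, map_smul' := by simp } :
      E →ₗ[ℂ] Cplx F)

theorem continuous_diag [FiniteDimensional ℂ E] (Φ : HermitianMap E F) : Continuous Φ.diag := by
  let b := Module.finBasis ℂ E
  have hb : ∀ i, Continuous fun ζ : E => b.repr ζ i := fun i =>
    LinearMap.continuous_of_finiteDimensional (b.coord i)
  have hrep : ∀ ζ ζ', Φ.toFun ζ ζ' =
      ∑ i, (starRingEnd ℂ (b.repr ζ' i)) • Φ.toFun ζ (b i) := fun ζ ζ' => by
    conv_lhs => rw [← b.sum_repr ζ']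
    rw [map_sum]
    simp only [map_smulₛₗ]
  refine Cplx.continuous_re.comp (?_ : Continuous fun ζ => Φ.toFun ζ ζ)
  rw [funext fun ζ => hrep ζ ζ]
  exact continuous_finsetSum _ fun i _ =>
    (Complex.continuous_conj.comp (hb i)).smul (Φ.continuous_toFun_left (b i))

theorem continuous_rho [FiniteDimensional ℂ E] (Φ : HermitianMap E F) :
    Continuous fun v : E × Cplx F => Φ.rho v.1 v.2 :=
  (Cplx.continuous_im.comp continuous_snd).sub (Φ.continuous_diag.comp continuous_fst)

theorem continuous_restr [FiniteDimensional ℂ E] (Φ : HermitianMap E F) {f : E × Cplx F → ℂ}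
    (hf : Continuous f) (h : F) : Continuous (Φ.restr f h) :=
  hf.comp (continuous_fst.prodMk (Cplx.continuous_mk.comp
    (continuous_snd.prodMk ((Φ.continuous_diag.comp continuous_fst).add continuous_const))))

theorem apply_eq_restr (Φ : HermitianMap E F) (f : E × Cplx F → ℂ) (ζ : E) (z : Cplx F) :
    f (ζ, z) = Φ.restr f (Φ.rho ζ z) (ζ, z.re) := by
  simp only [restr, rho, add_sub_cancel, Cplx.mk_re_im]

/-- The bound of `ExpType` with a real bound on the supporting function. -/
theorem ExpType.norm_le {Φ : HermitianMap E F} {K : Set (StrongDual ℝ F)} {f : E × Cplx F → ℂ}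
    (hf : Φ.ExpType K f) {ε : ℝ} (hε : 0 < ε) : ∃ C > 0, ∀ (ζ : E) (z : Cplx F) (s : ℝ),
      suppFun (K + Metric.closedBall (0 : StrongDual ℝ F) ε) (Φ.rho ζ z) ≤ s →
        ‖f (ζ, z)‖ ≤ C * Real.exp (C * (‖ζ‖ ^ 2 + ‖z.re‖) + s) := by
  obtain ⟨C, hC, h⟩ := hf ε hε
  refine ⟨C, hC, fun ζ z s hs => ?_⟩
  have h1 := (h ζ z).trans (mul_le_mul_right (EReal.exp_monotone (add_le_add_right hs _)) _)
  rw [← EReal.coe_add, EReal.exp_coe, ← ENNReal.ofReal_mul hC.le, ← ofReal_norm,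
    ENNReal.ofReal_le_ofReal_iff (by positivity)] at h1
  exact h1

/-- The restriction of `f` to the complex line through `(ζ, x + iΦ(ζ))` in the direction `h`. -/
noncomputable def line (Φ : HermitianMap E F) (f : E × Cplx F → ℂ) (h : F) (ξ : E × F) (w : ℂ) : ℂ :=
  f (ξ.1, Cplx.mk ξ.2 (Φ.diag ξ.1) + w • Cplx.mk h 0)

theorem continuous_line [FiniteDimensional ℂ E] (Φ : HermitianMap E F) {f : E × Cplx F → ℂ}
    (hf : Continuous f) (h : F) : Continuous fun q : (E × F) × ℂ => Φ.line f h q.1 q.2 := by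
  refine hf.comp ((continuous_fst.comp continuous_fst).prodMk (Continuous.add ?_
    (continuous_snd.smul continuous_const)))
  exact Cplx.continuous_mk.comp ((continuous_snd.comp continuous_fst).prodMk
    (Φ.continuous_diag.comp (continuous_fst.comp continuous_fst)))

theorem differentiable_line (Φ : HermitianMap E F) {f : E × Cplx F → ℂ}
    (hf : Differentiable ℂ f) (h : F) (ξ : E × F) : Differentiable ℂ (Φ.line f h ξ) := by
  unfold line
  fun_prop

theorem line_ofReal (Φ : HermitianMap E F) (f : E × Cplx F → ℂ) (h : F) (ξ : E × F) (t : ℝ) :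
    Φ.line f h ξ t = Φ.restr f 0 (ξ + (0, t • h)) := by
  simp only [line, restr, Prod.fst_add, Prod.snd_add, add_zero]
  congr 2
  exact Cplx.ext (by simp only [Cplx.re_add, Cplx.re_smul, Cplx.re_mk, Cplx.im_mk,
    Complex.ofReal_re, Complex.ofReal_im, zero_smul, sub_zero]) (by simp only [Cplx.im_add,
    Cplx.im_smul, Cplx.re_mk, Cplx.im_mk, Complex.ofReal_re, Complex.ofReal_im, zero_smul,
    smul_zero, add_zero])

theorem line_I (Φ : HermitianMap E F) (f : E × Cplx F → ℂ) (h : F) (ξ : E × F) :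
    Φ.line f h ξ Complex.I = Φ.restr f h ξ := by
  simp only [line, restr]
  congr 2
  exact Cplx.ext (by simp) (by simp)

/-- On this line `ρ = (Im w) h`, so the growth in `Im w` is governed by `H_K(h)`, while `Re z` grows
linearly in `Re w`. The constant is uniform on bounded sets of `ξ`, so the bound can be integrated
over them. -/
theorem ExpType.norm_line_le {Φ : HermitianMap E F} {K : Set (StrongDual ℝ F)}
    {f : E × Cplx F → ℂ} (hf : Φ.ExpType K f) {h : F} {a : ℝ} (ha : suppFun K h ≤ a) (R : ℝ)
    {ε : ℝ} (hε : 0 < ε) : ∃ C > 0, ∀ ξ : E × F, ‖ξ‖ ≤ R → ∀ w : ℂ, 0 ≤ w.im →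
      ‖Φ.line f h ξ w‖ ≤ C * Real.exp (C * |w.re| + (a + ε) * w.im) := by
  -- Chosen so that the loss `ε' ‖h‖` is at most `ε`; the `+ 1` covers `h = 0`.
  have hε' : 0 < ε / (‖h‖ + 1) := by positivity
  obtain ⟨C, hC, hle⟩ := hf.norm_le hε'
  refine ⟨C * Real.exp (C * (R ^ 2 + R)) + C * ‖h‖, by positivity, fun ξ hξ w hw => ?_⟩
  have h1 : ‖ξ.1‖ ≤ R := (norm_fst_le ξ).trans hξ
  have h2 : ‖ξ.2‖ ≤ R := (norm_snd_le ξ).trans hξ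
  set z : Cplx F := Cplx.mk ξ.2 (Φ.diag ξ.1) + w • Cplx.mk h 0 with hz
  have hrho : Φ.rho ξ.1 z = w.im • h := by simp [rho, hz]
  have hre : z.re = ξ.2 + w.re • h := by simp [hz]
  have h3 := hle ξ.1 z ((a + ε) * w.im) (by
    rw [hrho]
    refine (suppFun_add_closedBall_smul_le ha hw).trans (EReal.coe_le_coe ?_)
    gcongr
    rw [div_mul_eq_mul_div, div_le_iff₀ (by positivity)]
    nlinarith)
  refine h3.trans ?_
  have h4 : ‖z.re‖ ≤ R + |w.re| * ‖h‖ := by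
    rw [hre]
    refine (norm_add_le _ _).trans ?_
    rw [norm_smul, Real.norm_eq_abs]
    gcongr
  have h5 : ‖ξ.1‖ ^ 2 ≤ R ^ 2 := by gcongr
  have hR : 0 ≤ R := (norm_nonneg _).trans hξ
  calc C * Real.exp (C * (‖ξ.1‖ ^ 2 + ‖z.re‖) + (a + ε) * w.im)
      ≤ C * Real.exp (C * (R ^ 2 + (R + |w.re| * ‖h‖)) + (a + ε) * w.im) := by gcongr
    _ = C * Real.exp (C * (R ^ 2 + R)) * Real.exp (C * ‖h‖ * |w.re| + (a + ε) * w.im) := by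
        rw [mul_assoc, ← Real.exp_add]
        ring_nf
    _ ≤ _ := by
        gcongr
        · exact le_add_of_nonneg_right (by positivity)
        · exact le_add_of_nonneg_left (by positivity)

/-- The maximum principle: a bound for `f_0` on a fibre gives one for `f_h`. -/
theorem ExpType.norm_restr_le {Φ : HermitianMap E F} {K : Set (StrongDual ℝ F)}
    {f : E × Cplx F → ℂ} (hf : Φ.ExpType K f) (hfd : Differentiable ℂ f) {h : F} {a : ℝ}
    (ha : suppFun K h ≤ a) {M : ℝ} {ζ : E} (hM : ∀ x, ‖Φ.restr f 0 (ζ, x)‖ ≤ M) (x : F) :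
    ‖Φ.restr f h (ζ, x)‖ ≤ M * Real.exp a := by
  have hu := LogSubharmonic.of_norm_rpow (Φ.differentiable_line hfd h (ζ, x)) one_pos
  simp only [Real.rpow_one] at hu
  have := hu.le_mul_exp_of_growth (a := a) ((norm_nonneg _).trans (hM 0))
    (fun ε hε => ?_) (fun t => ?_) Complex.I (by simp)
  · simpa [line_I] using this
  · obtain ⟨C, hC, hle⟩ := hf.norm_line_le ha ‖(ζ, x)‖ hε
    exact ⟨C, hC, hle _ le_rfl⟩
  · rw [line_ofReal]
    simpa using hM _

end HermitianMap

end Basics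

/-! ### The Plancherel-Pólya inequality -/

section Measure

variable {E F : Type*} [NormedAddCommGroup E] [InnerProductSpace ℂ E]
  [FiniteDimensional ℂ E] [MeasurableSpace E] [BorelSpace E]
  [NormedAddCommGroup F] [InnerProductSpace ℝ F] [FiniteDimensional ℝ F] [MeasurableSpace F]
  [BorelSpace F]

variable (E F) in
theorem exists_lebesgue_eq_prod : ∃ μ : Measure E, μ.IsAddHaarMeasure ∧
    lebesgue E F = μ.prod (volume : Measure F) := by
  let : InnerProductSpace ℝ E := InnerProductSpace.rclikeToReal ℂ E
  exact ⟨volume, inferInstance, rfl⟩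

/-- The Plancherel-Pólya inequality `‖f_h‖_p ≤ e^{H_K(h)} ‖f_0‖_p`. -/
theorem HermitianMap.ExpType.lintegral_restr_le {Φ : HermitianMap E F}
    {K : Set (StrongDual ℝ F)} {f : E × Cplx F → ℂ} (hf : Φ.ExpType K f)
    (hfd : Differentiable ℂ f) {p : ℝ} (hp : 0 < p)
    (hfp : ∫⁻ ξ, ‖Φ.restr f 0 ξ‖ₑ ^ p ∂(lebesgue E F) ≠ ∞)
    {h : F} {a : ℝ} (ha : suppFun K h ≤ a) :
    ∫⁻ ξ, ‖Φ.restr f h ξ‖ₑ ^ p ∂(lebesgue E F) ≤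
      ENNReal.ofReal (Real.exp (p * a)) * ∫⁻ ξ, ‖Φ.restr f 0 ξ‖ₑ ^ p ∂(lebesgue E F) := by
  have : ProperSpace E := FiniteDimensional.proper ℂ E
  have : ProperSpace F := FiniteDimensional.proper ℝ F
  obtain ⟨ν, hν, hνe⟩ := exists_lebesgue_eq_prod E F
  have : (lebesgue E F).IsAddHaarMeasure := by rw [hνe]; infer_instance
  have : SFinite (lebesgue E F) := inferInstance
  set μ := lebesgue E F
  have henorm : ∀ g : E × F → ℂ, ∀ ξ, ‖g ξ‖ₑ ^ p = ENNReal.ofReal (‖g ξ‖ ^ p) := fun g ξ => by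
    rw [← ofReal_norm, ENNReal.ofReal_rpow_of_nonneg (norm_nonneg _) hp.le]
  have hcp : ∀ h, Continuous fun ξ => ‖Φ.restr f h ξ‖ ^ p := fun h =>
    (Φ.continuous_restr hfd.continuous h).norm.rpow_const fun _ => Or.inr hp.le
  simp only [henorm] at hfp ⊢
  have hint : Integrable (fun ξ => ‖Φ.restr f 0 ξ‖ ^ p) μ :=
    (lintegral_ofReal_ne_top_iff_integrable (hcp 0).aestronglyMeasurable
      (Filter.Eventually.of_forall fun _ => by positivity)).1 hfp
  set M := ∫ ξ, ‖Φ.restr f 0 ξ‖ ^ p ∂μ with hM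
  have hM0 : 0 ≤ M := integral_nonneg fun _ => by positivity
  -- The growth hypothesis is uniform only for bounded `ξ`, hence the integral is first taken over a
  -- ball; the bound obtained does not depend on `R`, so the balls can exhaust `𝒩`.
  have hball : ∀ R : ℝ, ∫ ξ in Metric.closedBall (0 : E × F) R, ‖Φ.restr f h ξ‖ ^ p ∂μ ≤
      M * Real.exp (p * a) := by
    intro R
    have hB := isCompact_closedBall (0 : E × F) R
    have hu := LogSubharmonic.setIntegral_norm_rpow (μ := μ) hB
      (Φ.continuous_line hfd.continuous h) (Φ.differentiable_line hfd h) hp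
    have := hu.le_mul_exp_of_growth (a := p * a) hM0 (fun ε hε => ?_) (fun t => ?_)
      Complex.I (by simp)
    · simpa [HermitianMap.line_I] using this
    · obtain ⟨C, hC, hle⟩ := hf.norm_line_le ha R (div_pos hε hp)
      refine ⟨C ^ p * (μ.real (Metric.closedBall 0 R) + 1) + p * C, by positivity, fun w hw => ?_⟩
      have h1 : ∀ ξ ∈ Metric.closedBall (0 : E × F) R, ‖Φ.line f h ξ w‖ ^ p ≤
          C ^ p * Real.exp (p * C * |w.re| + (p * a + ε) * w.im) := fun ξ hξ => by
        refine (Real.rpow_le_rpow (norm_nonneg _) (hle ξ (by simpa using hξ) w hw) hp.le).trans_eq ?_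
        rw [Real.mul_rpow hC.le (Real.exp_pos _).le, ← Real.exp_mul]
        congr 2
        field_simp
      have hci : IntegrableOn (fun ξ => ‖Φ.line f h ξ w‖ ^ p) (Metric.closedBall 0 R) μ := by
        refine ContinuousOn.integrableOn_compact hB (Continuous.continuousOn ?_)
        exact ((Φ.continuous_line hfd.continuous h).comp
          (continuous_id.prodMk continuous_const)).norm.rpow_const fun _ => Or.inr hp.le
      have hconst : IntegrableOn (fun _ : E × F =>
          C ^ p * Real.exp (p * C * |w.re| + (p * a + ε) * w.im)) (Metric.closedBall 0 R) μ :=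
        continuousOn_const.integrableOn_compact hB
      refine (setIntegral_mono_on hci hconst Metric.isClosed_closedBall.measurableSet h1).trans ?_
      rw [setIntegral_const, smul_eq_mul, ← mul_assoc, mul_comm (μ.real _)]
      have hm : 0 ≤ μ.real (Metric.closedBall (0 : E × F) R) := measureReal_nonneg
      have hCp : 0 < C ^ p := by positivity
      gcongr
      · nlinarith [mul_pos hp hC]
      · exact le_add_of_nonneg_left (by positivity)
    -- For real `t` the line only translates `f_0`, and Lebesgue measure is invariant.
    · simp only [HermitianMap.line_ofReal]
      calc ∫ ξ in Metric.closedBall (0 : E × F) R, ‖Φ.restr f 0 (ξ + (0, t • h))‖ ^ p ∂μ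
          ≤ ∫ ξ, ‖Φ.restr f 0 (ξ + (0, t • h))‖ ^ p ∂μ :=
            setIntegral_le_integral (hint.comp_add_right _)
              (Filter.Eventually.of_forall fun _ => by positivity)
        _ = M := integral_add_right_eq_self (fun ξ => ‖Φ.restr f 0 ξ‖ ^ p) _
  have hlball : ∀ n : ℕ, ∫⁻ ξ in Metric.closedBall (0 : E × F) n,
      ENNReal.ofReal (‖Φ.restr f h ξ‖ ^ p) ∂μ ≤ ENNReal.ofReal (M * Real.exp (p * a)) := fun n => by
    rw [← ofReal_integral_eq_lintegral_ofReal
      ((hcp h).continuousOn.integrableOn_compact (isCompact_closedBall _ _))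
      (Filter.Eventually.of_forall fun _ => by positivity)]
    exact ENNReal.ofReal_le_ofReal (hball n)
  rw [← ofReal_integral_eq_lintegral_ofReal hint
    (Filter.Eventually.of_forall fun _ => by positivity), ← ENNReal.ofReal_mul (Real.exp_pos _).le,
    mul_comm (Real.exp _), ← setLIntegral_univ, ← Metric.iUnion_closedBall_nat (0 : E × F),
    setLIntegral_iUnion_of_directed]
  · exact iSup_le hlball
  · exact directed_of_isDirected_le fun m n hmn => Metric.closedBall_subset_closedBall
      (by exact_mod_cast hmn)

end Measure

/-! ### The sub-mean value inequality on balls -/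

section Rotation

variable {V : Type*} [NormedAddCommGroup V] [NormedSpace ℂ V] [ProperSpace V]
  [MeasurableSpace V] [BorelSpace V]

/-- By uniqueness of Haar measure the image is a multiple of `m`; the unit ball is invariant, so the
factor is `1`. -/
theorem measurePreserving_smul_of_norm_eq_one (m : Measure V) [m.IsAddHaarMeasure] {w : ℂ}
    (hw : ‖w‖ = 1) : MeasurePreserving (fun v : V => w • v) m m := by
  have hw0 : w ≠ 0 := fun h => by simp [h] at hw
  let e : V ≃+ V := (LinearEquiv.smulOfNeZero ℂ V w hw0).toAddEquiv
  have he : Continuous e := continuous_const_smul w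
  have he' : Continuous e.symm := continuous_const_smul (w⁻¹)
  have hm : (m.map e).IsAddHaarMeasure := e.isAddHaarMeasure_map m he he'
  obtain ⟨c, hc⟩ : ∃ c : ℝ≥0∞, m.map e = c • m :=
    ⟨_, Measure.isAddLeftInvariant_eq_smul (m.map e) m⟩
  have hpre : e ⁻¹' Metric.closedBall 0 1 = Metric.closedBall 0 1 := by
    ext v
    have : ‖e v‖ = ‖v‖ := by
      change ‖w • v‖ = ‖v‖
      rw [norm_smul, hw, one_mul]
    simp [this]
  have h1 : m (Metric.closedBall 0 1) = c * m (Metric.closedBall 0 1) := by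
    have := congrArg (fun ν : Measure V => ν (Metric.closedBall 0 1)) hc
    simpa [Measure.map_apply he.measurable Metric.isClosed_closedBall.measurableSet, hpre]
      using this
  have hpos : m (Metric.closedBall 0 1) ≠ 0 := (Metric.measure_closedBall_pos m 0 one_pos).ne'
  have hfin : m (Metric.closedBall 0 1) ≠ ∞ := measure_closedBall_lt_top.ne
  have hc1 : c = 1 := by
    rw [eq_comm, ENNReal.mul_eq_right hpos hfin] at h1
    exact h1
  exact ⟨he.measurable, by rw [hc1, one_smul] at hc; exact hc⟩

/-- The sub-mean value inequality for `‖f‖ ^ p` on balls. -/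
theorem Differentiable.enorm_rpow_mul_measure_le (m : Measure V) [m.IsAddHaarMeasure] {f : V → ℂ}
    (hf : Differentiable ℂ f) {p : ℝ} (hp : 0 < p) :
    ‖f 0‖ₑ ^ p * m (Metric.closedBall 0 1) ≤ ∫⁻ v in Metric.closedBall 0 1, ‖f v‖ₑ ^ p ∂m := by
  have henorm : ∀ v, ‖f v‖ₑ ^ p = ENNReal.ofReal (‖f v‖ ^ p) := fun v => by
    rw [← ofReal_norm, ENNReal.ofReal_rpow_of_nonneg (norm_nonneg _) hp.le]
  set S : Set ℝ := Ioc 0 (2 * Real.pi) with hS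
  let e : ℝ → ℂ := circleMap 0 1
  have he : Continuous e := continuous_circleMap 0 1
  have hnorm : ∀ θ, ‖e θ‖ = 1 := fun θ => by simp [e]
  -- On each complex line through `0` this is the one-variable inequality on a circle. Integrating
  -- over `v` in the ball and exchanging integrals, each rotation drops out by invariance.
  have hcirc : ∀ v, ‖f 0‖ₑ ^ p * volume S ≤ ∫⁻ θ in S, ‖f (e θ • v)‖ₑ ^ p := by
    intro v
    have hG : Differentiable ℂ fun w : ℂ => f (w • v) := by fun_prop
    have h1 := (LogSubharmonic.of_norm_rpow hG hp).le_circleAverage 0 one_pos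
    rw [Real.circleAverage_def, zero_smul, smul_eq_mul, ← div_eq_inv_mul,
      le_div_iff₀ Real.two_pi_pos, intervalIntegral.integral_of_le Real.two_pi_pos.le] at h1
    have hc : Continuous fun θ : ℝ => ‖f (e θ • v)‖ ^ p :=
      (hf.continuous.comp (he.smul continuous_const)).norm.rpow_const fun _ => Or.inr hp.le
    simp only [henorm]
    rw [← ofReal_integral_eq_lintegral_ofReal
      ((hc.continuousOn.integrableOn_compact isCompact_Icc).mono_set Ioc_subset_Icc_self)
      (Filter.Eventually.of_forall fun _ => by positivity), hS, Real.volume_Ioc, sub_zero,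
      ← ENNReal.ofReal_mul (by positivity)]
    exact ENNReal.ofReal_le_ofReal h1
  have hmeas : Measurable fun q : V × ℝ => ‖f (e q.2 • q.1)‖ₑ ^ p :=
    ((hf.continuous.comp ((he.comp continuous_snd).smul continuous_fst)).enorm.measurable).pow_const
      p
  have hrot : ∀ θ, ∫⁻ v in Metric.closedBall 0 1, ‖f (e θ • v)‖ₑ ^ p ∂m =
      ∫⁻ v in Metric.closedBall 0 1, ‖f v‖ₑ ^ p ∂m := by
    intro θ
    have hpre : (fun v : V => e θ • v) ⁻¹' Metric.closedBall 0 1 = Metric.closedBall 0 1 := by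
      ext v
      simp [norm_smul, hnorm]
    have := (measurePreserving_smul_of_norm_eq_one m (hnorm θ)).setLIntegral_comp_preimage
      (f := fun v => ‖f v‖ₑ ^ p) Metric.isClosed_closedBall.measurableSet
      (hf.continuous.enorm.measurable.pow_const p) (s := Metric.closedBall 0 1)
    rwa [hpre] at this
  have hSpos : volume S ≠ 0 := by simp [hS, Real.pi_pos]
  have hSfin : volume S ≠ ∞ := by simp [hS, ENNReal.mul_eq_top]
  have hkey : ‖f 0‖ₑ ^ p * m (Metric.closedBall 0 1) * volume S ≤
      (∫⁻ v in Metric.closedBall 0 1, ‖f v‖ₑ ^ p ∂m) * volume S := by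
    calc ‖f 0‖ₑ ^ p * m (Metric.closedBall 0 1) * volume S
        = ∫⁻ _ in Metric.closedBall (0 : V) 1, ‖f 0‖ₑ ^ p * volume S ∂m := by
          rw [setLIntegral_const]
          ring
      _ ≤ ∫⁻ v in Metric.closedBall 0 1, (∫⁻ θ in S, ‖f (e θ • v)‖ₑ ^ p) ∂m :=
          lintegral_mono fun v => hcirc v
      _ = ∫⁻ θ in S, ∫⁻ v in Metric.closedBall 0 1, ‖f (e θ • v)‖ₑ ^ p ∂m :=
          lintegral_lintegral_swap hmeas.aemeasurable
      _ = _ := by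
          simp only [hrot, setLIntegral_const]
  exact (ENNReal.mul_le_mul_iff_left hSpos hSfin).1 hkey

end Rotation

/-! ### Point evaluations on `𝒩` for finite `p` -/

section Pointwise

variable {E F : Type*} [NormedAddCommGroup E] [InnerProductSpace ℂ E]
  [FiniteDimensional ℂ E] [MeasurableSpace E] [BorelSpace E]
  [NormedAddCommGroup F] [InnerProductSpace ℝ F] [FiniteDimensional ℝ F] [MeasurableSpace F]
  [BorelSpace F]

namespace Cplx

noncomputable instance : MeasurableSpace (Cplx F) := borel _

instance : BorelSpace (Cplx F) := ⟨rfl⟩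

/-- `F × F` and `F_ℂ` as additive groups. -/
noncomputable def prodAddEquiv (F : Type*) [NormedAddCommGroup F] [InnerProductSpace ℝ F] :
    F × F ≃+ Cplx F where
  toFun q := mk q.1 q.2
  invFun z := (z.re, z.im)
  left_inv _ := rfl
  right_inv _ := rfl
  map_add' _ _ := rfl

instance : ProperSpace (Cplx F) :=
  inferInstanceAs (ProperSpace (WithLp 2 (F × F)))

end Cplx

namespace HermitianMap

theorem diag_add (Φ : HermitianMap E F) (ζ₀ ζ : E) :
    Φ.diag (ζ₀ + ζ) = Φ.diag ζ₀ + (2 : ℝ) • (Φ.toFun ζ ζ₀).re + Φ.diag ζ := by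
  simp only [diag, map_add, LinearMap.add_apply, Cplx.re_add, Φ.conj_symm ζ ζ₀, two_smul]
  simp only [Cplx.conj, Cplx.re_mk]
  abel

/-- The composition of `f` with the left translation by `(ζ₀, x₀)` of the group `𝒩`, acting on
`E × F_ℂ`. -/
noncomputable def translate (Φ : HermitianMap E F) (f : E × Cplx F → ℂ) (ξ₀ : E × F) (v : E × Cplx F) : ℂ :=
  f (ξ₀.1 + v.1, Cplx.mk ξ₀.2 (Φ.diag ξ₀.1) + (2 * Complex.I) • Φ.toFun v.1 ξ₀.1 + v.2)

theorem differentiable_translate (Φ : HermitianMap E F) {f : E × Cplx F → ℂ}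
    (hf : Differentiable ℂ f) (ξ₀ : E × F) : Differentiable ℂ (Φ.translate f ξ₀) := by
  let L : E →L[ℂ] Cplx F := LinearMap.toContinuousLinearMap
    ({ toFun := fun ζ => Φ.toFun ζ ξ₀.1, map_add' := by simp, map_smul' := by simp } :
      E →ₗ[ℂ] Cplx F)
  have hL : Differentiable ℂ fun v : E × Cplx F => Φ.toFun v.1 ξ₀.1 :=
    L.differentiable.comp differentiable_fst
  unfold translate
  fun_prop

theorem translate_zero (Φ : HermitianMap E F) (f : E × Cplx F → ℂ) (ξ₀ : E × F) :
    Φ.translate f ξ₀ 0 = Φ.restr f 0 ξ₀ := by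
  simp [translate, restr]

/-- Left translations of `𝒩` preserve `ρ`: the height is `y - Φ(ζ)` whatever `ξ₀` is, so it is
bounded on the unit ball uniformly in `ξ₀`. The remaining shift of `x` depends only on `ζ` and
disappears on integration. -/
theorem translate_mk (Φ : HermitianMap E F) (f : E × Cplx F → ℂ) (ξ₀ : E × F) (ζ : E) (x y : F) :
    Φ.translate f ξ₀ (ζ, Cplx.mk x y) = Φ.restr f (y + -Φ.diag ζ)
      (ζ + ξ₀.1, x + (ξ₀.2 - (2 : ℝ) • (Φ.toFun ζ ξ₀.1).im)) := by
  simp only [translate, restr]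
  rw [add_comm ξ₀.1 ζ, add_comm ζ, diag_add]
  congr 2
  refine Cplx.ext ?_ ?_
  · simp
    abel
  · simp
    abel

theorem measurable_restr (Φ : HermitianMap E F) {f : E × Cplx F → ℂ} (hf : Continuous f) :
    Measurable fun q : F × E × F => ‖Φ.restr f q.1 q.2‖ₑ := by
  have : SecondCountableTopology E := inferInstance
  refine (Continuous.enorm (hf.comp ?_)).measurable
  refine (continuous_fst.comp continuous_snd).prodMk (Cplx.continuous_mk.comp
    ((continuous_snd.comp continuous_snd).prodMk
      ((Φ.continuous_diag.comp (continuous_fst.comp continuous_snd)).add continuous_fst)))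

end HermitianMap

/-- Point evaluations on `𝒩` are bounded by the `L^p` quasi-norm, for `p < ∞`. -/
theorem HermitianMap.exists_enorm_restr_rpow_le (Φ : HermitianMap E F)
    {K : Set (StrongDual ℝ F)} (hK : IsCompact K) {p : ℝ} (hp : 0 < p) :
    ∃ C : ℝ≥0∞, C ≠ ∞ ∧ ∀ f : E × Cplx F → ℂ, Differentiable ℂ f → Φ.ExpType K f →
      ∫⁻ ξ, ‖Φ.restr f 0 ξ‖ₑ ^ p ∂(lebesgue E F) ≠ ∞ → ∀ ξ₀, ‖Φ.restr f 0 ξ₀‖ₑ ^ p ≤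
        C * ∫⁻ ξ, ‖Φ.restr f 0 ξ‖ₑ ^ p ∂(lebesgue E F) := by
  have : ProperSpace E := FiniteDimensional.proper ℂ E
  have : ProperSpace F := FiniteDimensional.proper ℝ F
  obtain ⟨ν, hν, hνe⟩ := exists_lebesgue_eq_prod E F
  obtain ⟨R, hR⟩ := hK.isBounded.exists_norm_le
  obtain ⟨D, hD⟩ :=
    ((isCompact_closedBall (0 : E) 1).image Φ.continuous_diag).isBounded.exists_norm_le
  let e := Cplx.prodAddEquiv F
  have he : Continuous e := Cplx.continuous_mk
  have he' : Continuous e.symm := Cplx.continuous_re.prodMk Cplx.continuous_im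
  let κ : Measure (Cplx F) := (volume.prod volume : Measure (F × F)).map e
  have hκ : κ.IsAddHaarMeasure := e.isAddHaarMeasure_map _ he he'
  let m : Measure (E × Cplx F) := ν.prod κ
  have hm : m.IsAddHaarMeasure := inferInstance
  -- `B` contains every height `y - Φ(ζ)` that occurs on the unit ball.
  let B : Set F := Metric.closedBall 0 (1 + D)
  have hBm : MeasurableSet B := Metric.isClosed_closedBall.measurableSet
  have hBfin : volume B ≠ ∞ := measure_closedBall_lt_top.ne
  set b := m (Metric.closedBall 0 1) with hb
  have hbpos : b ≠ 0 := (Metric.measure_closedBall_pos m 0 one_pos).ne'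
  have hbfin : b ≠ ∞ := measure_closedBall_lt_top.ne
  -- `R` may be negative when `K = ∅`; `max R 0` makes the bound monotone in `‖h‖`.
  refine ⟨b⁻¹ * (volume B * ENNReal.ofReal (Real.exp (p * (max R 0 * (1 + D))))),
    ENNReal.mul_ne_top (ENNReal.inv_ne_top.2 hbpos) (ENNReal.mul_ne_top hBfin ENNReal.ofReal_ne_top),
    fun f hfd hf hfp ξ₀ => ?_⟩
  set I := ∫⁻ ξ, ‖Φ.restr f 0 ξ‖ₑ ^ p ∂(lebesgue E F) with hI
  let Ψ : F → E → F → ℝ≥0∞ := fun h ζ x => B.indicator (fun _ => ‖Φ.restr f h (ζ, x)‖ₑ ^ p) h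
  have hΨ : Measurable fun q : F × E × F => Ψ q.1 q.2.1 q.2.2 := by
    have h1 := (Φ.measurable_restr hfd.continuous).pow_const p
    have : (fun q : F × E × F => Ψ q.1 q.2.1 q.2.2) =
        (Prod.fst ⁻¹' B).indicator fun q : F × E × F => ‖Φ.restr f q.1 q.2‖ₑ ^ p := rfl
    rw [this]
    exact h1.indicator (measurable_fst hBm)
  have hΨint : ∀ h, ∫⁻ ζ, (∫⁻ x, Ψ h ζ x) ∂ν ≤
      B.indicator (fun _ => ENNReal.ofReal (Real.exp (p * (max R 0 * (1 + D)))) * I) h := by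
    intro h
    by_cases hh : h ∈ B
    · simp only [Ψ, Set.indicator_of_mem hh]
      have h1 : AEMeasurable (fun ξ : E × F => ‖Φ.restr f h ξ‖ₑ ^ p) (ν.prod volume) :=
        ((Φ.continuous_restr hfd.continuous h).enorm.measurable.pow_const p).aemeasurable
      have h2 := lintegral_prod _ h1
      rw [← h2, ← hνe]
      refine hf.lintegral_restr_le hfd hp hfp ((suppFun_le_mul_norm (R := max R 0)
        (fun l hl => (hR l hl).trans (le_max_left _ _)) h).trans (EReal.coe_le_coe ?_))
      have : ‖h‖ ≤ 1 + D := by simpa [B] using hh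
      gcongr
    · simp [Ψ, Set.indicator_of_notMem hh]
  have hsub := (Φ.differentiable_translate hfd ξ₀).enorm_rpow_mul_measure_le m hp
  rw [Φ.translate_zero, ← hb] at hsub
  have hle : ∫⁻ v in Metric.closedBall 0 1, ‖Φ.translate f ξ₀ v‖ₑ ^ p ∂m ≤
      volume B * ENNReal.ofReal (Real.exp (p * (max R 0 * (1 + D)))) * I := by
    let g : E × Cplx F → ℝ≥0∞ := fun v =>
      (Metric.closedBall 0 1).indicator (fun v => ‖Φ.translate f ξ₀ v‖ₑ ^ p) v
    have hg : Measurable g :=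
      ((Φ.differentiable_translate hfd ξ₀).continuous.enorm.measurable.pow_const p).indicator
        Metric.isClosed_closedBall.measurableSet
    have hgΨ : ∀ ζ x y, g (ζ, Cplx.mk x y) ≤ Ψ (y + -Φ.diag ζ) (ζ + ξ₀.1)
        (x + (ξ₀.2 - (2 : ℝ) • (Φ.toFun ζ ξ₀.1).im)) := by
      intro ζ x y
      by_cases hv : (ζ, Cplx.mk x y) ∈ Metric.closedBall (0 : E × Cplx F) 1
      · have hv' : ‖(ζ, Cplx.mk x y)‖ ≤ 1 := by simpa using hv
        have h1 : ‖ζ‖ ≤ 1 := (norm_fst_le _).trans hv'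
        have h2 : ‖Cplx.mk x y‖ ≤ 1 := (norm_snd_le (ζ, Cplx.mk x y)).trans hv'
        have h3 : ‖y‖ ≤ 1 := by
          refine le_trans ?_ h2
          rw [← sq_le_sq₀ (norm_nonneg _) (norm_nonneg _), Cplx.norm_sq_eq]
          simp
        have h4 : ‖Φ.diag ζ‖ ≤ D := hD _ ⟨ζ, by simpa using h1, rfl⟩
        have h5 : y + -Φ.diag ζ ∈ B := by
          simp only [B, mem_closedBall_zero_iff]
          exact (norm_add_le _ _).trans (by rw [norm_neg]; linarith)
        simp only [g, Ψ, Set.indicator_of_mem hv, Set.indicator_of_mem h5, Φ.translate_mk, le_refl]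
      · simp [g, Set.indicator_of_notMem hv]
    rw [← lintegral_indicator Metric.isClosed_closedBall.measurableSet]
    change ∫⁻ v, g v ∂m ≤ _
    -- For fixed `ζ`, the variable `y` is replaced by the height `h = y - Φ(ζ)`; translation
    -- invariance removes the other shifts, and Tonelli brings the integral over `h` outside, so
    -- that Plancherel-Pólya applies for each `h`.
    calc ∫⁻ v, g v ∂m = ∫⁻ ζ, ∫⁻ z, g (ζ, z) ∂κ ∂ν := lintegral_prod _ hg.aemeasurable
      _ = ∫⁻ ζ, (∫⁻ y, ∫⁻ x, g (ζ, Cplx.mk x y)) ∂ν := by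
          refine lintegral_congr fun ζ => ?_
          have hgζ : Measurable fun z => g (ζ, z) := hg.comp measurable_prodMk_left
          rw [lintegral_map hgζ he.measurable]
          exact lintegral_prod_symm _ (hgζ.comp he.measurable).aemeasurable
      _ ≤ ∫⁻ ζ, (∫⁻ y, ∫⁻ x, Ψ (y + -Φ.diag ζ) (ζ + ξ₀.1)
            (x + (ξ₀.2 - (2 : ℝ) • (Φ.toFun ζ ξ₀.1).im))) ∂ν :=
          lintegral_mono fun ζ => lintegral_mono fun y => lintegral_mono fun x => hgΨ ζ x y
      _ = ∫⁻ ζ, (∫⁻ h, ∫⁻ x, Ψ h (ζ + ξ₀.1) x) ∂ν := by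
          refine lintegral_congr fun ζ => ?_
          simp only [fun h => lintegral_add_right_eq_self (μ := (volume : Measure F))
            (fun x => Ψ h (ζ + ξ₀.1) x)]
          exact lintegral_add_right_eq_self (μ := (volume : Measure F))
            (fun h => ∫⁻ x, Ψ h (ζ + ξ₀.1) x) _
      _ = ∫⁻ ζ, (∫⁻ h, ∫⁻ x, Ψ h ζ x) ∂ν :=
          lintegral_add_right_eq_self (μ := ν) (fun ζ => ∫⁻ h, ∫⁻ x, Ψ h ζ x) _
      _ = ∫⁻ h, ∫⁻ ζ, (∫⁻ x, Ψ h ζ x) ∂ν := by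
          refine lintegral_lintegral_swap (Measurable.aemeasurable ?_)
          have h1 : Measurable fun q : (E × F) × F => Ψ q.1.2 q.1.1 q.2 :=
            hΨ.comp (measurable_fst.snd.prodMk (measurable_fst.fst.prodMk measurable_snd))
          exact h1.lintegral_prod_right'
      _ ≤ ∫⁻ h, B.indicator
            (fun _ => ENNReal.ofReal (Real.exp (p * (max R 0 * (1 + D)))) * I) h :=
          lintegral_mono hΨint
      _ = _ := by
          rw [lintegral_indicator hBm, setLIntegral_const]
          ring
  calc ‖Φ.restr f 0 ξ₀‖ₑ ^ p = b⁻¹ * (‖Φ.restr f 0 ξ₀‖ₑ ^ p * b) := by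
        rw [mul_comm _ b, ← mul_assoc, ENNReal.inv_mul_cancel hbpos hbfin, one_mul]
    _ ≤ b⁻¹ * (volume B * ENNReal.ofReal (Real.exp (p * (max R 0 * (1 + D)))) * I) :=
        mul_le_mul_right (hsub.trans hle) _
    _ = _ := by ring

end Pointwise

/-! ### Locally uniform limits of entire functions -/

/-- A locally uniform limit of entire functions on a complex normed space is entire. -/
theorem Differentiable.of_tendstoUniformlyOn_nhds {V : Type*} [NormedAddCommGroup V]
    [NormedSpace ℂ V] {f : ℕ → V → ℂ} {g : V → ℂ}
    (hfg : ∀ v, ∃ t ∈ 𝓝 v, TendstoUniformlyOn f g Filter.atTop t) (hf : ∀ n, Differentiable ℂ (f n)) :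
    Differentiable ℂ g := by
  intro v₀
  obtain ⟨t, ht, htu⟩ := hfg v₀
  have hu := htu.uniformCauchySeqOn
  obtain ⟨r, hr, hrt⟩ := Metric.mem_nhds_iff.1 ht
  have hfd : UniformCauchySeqOn (fun n => fderiv ℂ (f n)) Filter.atTop
      (Metric.ball v₀ (r / 2)) := by
    rw [Metric.uniformCauchySeqOn_iff] at hu ⊢
    intro ε hε
    -- With this choice `f m - f n` varies by at most `(ε / 2)(r / 2)` on a ball of radius `r / 2`,
    -- and Cauchy's estimate bounds its derivative by `ε / 2`.
    obtain ⟨N, hN⟩ := hu (ε * (r / 2) / 4) (by positivity)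
    refine ⟨N, fun m hm n hn v hv => ?_⟩
    have hsub : Metric.ball v (r / 2) ⊆ t := fun y hy => hrt (by
      rw [Metric.mem_ball] at *
      linarith [dist_triangle y v v₀])
    rw [dist_eq_norm, ← fderiv_sub (hf m v) (hf n v)]
    have hmap : MapsTo (f m - f n) (Metric.ball v (r / 2))
        (Metric.closedBall ((f m - f n) v) (ε / 2 * (r / 2))) := fun y hy => by
      have h1 := hN m hm n hn y (hsub hy)
      have h2 := hN m hm n hn v (hsub (Metric.mem_ball_self (half_pos hr)))
      rw [dist_eq_norm] at h1 h2
      rw [Metric.mem_closedBall, dist_eq_norm, Pi.sub_apply, Pi.sub_apply]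
      linarith [norm_sub_le (f m y - f n y) (f m v - f n v)]
    have := Complex.norm_fderiv_le_div_of_mapsTo_ball
      ((hf m).sub (hf n)).differentiableOn hmap (half_pos hr)
    rw [mul_div_cancel_right₀ _ (half_pos hr).ne'] at this
    linarith
  have hlim : ∀ v ∈ Metric.ball v₀ (r / 2), ∃ L, Filter.Tendsto (fun n => fderiv ℂ (f n) v)
      Filter.atTop (𝓝 L) := fun v hv =>
    cauchySeq_tendsto_of_complete (hfd.cauchySeq hv)
  choose! g' hg' using hlim
  exact (hasFDerivAt_of_tendstoUniformlyOn Metric.isOpen_ball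
    (hfd.tendstoUniformlyOn_of_tendsto hg') (fun n v _ => (hf n v).hasFDerivAt)
    (fun v _ => by
      obtain ⟨t, ht, htu⟩ := hfg v
      exact htu.tendsto_at (mem_of_mem_nhds ht))
    (Metric.mem_ball_self (half_pos hr))).differentiableAt

/-! ### The pointwise estimate, the quasi-norm and Cauchy sequences -/

section Main

variable {E F : Type*} [NormedAddCommGroup E] [InnerProductSpace ℂ E]
  [FiniteDimensional ℂ E] [MeasurableSpace E] [BorelSpace E]
  [NormedAddCommGroup F] [InnerProductSpace ℝ F] [FiniteDimensional ℝ F] [MeasurableSpace F]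
  [BorelSpace F]

/-- A bound with `H_K` gives one with every `H_{K + B(0, ε)}`, which is larger. This is the form of
the growth condition that survives limits, as its constant does not depend on `ε`. -/
theorem HermitianMap.ExpType.of_norm_le {Φ : HermitianMap E F} {K : Set (StrongDual ℝ F)}
    {g : E × Cplx F → ℂ} {D : ℝ} (hD : 0 ≤ D)
    (hg : ∀ ζ z (a : ℝ), suppFun K (Φ.rho ζ z) ≤ a → ‖g (ζ, z)‖ ≤ D * Real.exp a) :
    Φ.ExpType K g := by
  intro ε hε
  refine ⟨D + 1, by positivity, fun ζ z => ?_⟩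
  have hle : suppFun K (Φ.rho ζ z) ≤
      suppFun (K + Metric.closedBall (0 : StrongDual ℝ F) ε) (Φ.rho ζ z) :=
    suppFun_mono (fun k hk => Set.mem_add.2 ⟨k, hk, 0, by simpa using hε.le, add_zero k⟩) _
  have hpos : ENNReal.ofReal (D + 1) ≠ 0 := by
    rw [ne_eq, ENNReal.ofReal_eq_zero]
    linarith
  induction hs : suppFun (K + Metric.closedBall (0 : StrongDual ℝ F) ε) (Φ.rho ζ z) with
  | bot =>
    rw [hs] at hle
    -- Here every real `a` is admissible, and `a → -∞` forces `g` to vanish at the point.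
    have hlim : Filter.Tendsto (fun a : ℝ => D * Real.exp a) Filter.atBot (𝓝 0) := by
      simpa using Real.tendsto_exp_atBot.const_mul D
    have h0 : ‖g (ζ, z)‖ ≤ 0 := ge_of_tendsto hlim
      (Filter.Eventually.of_forall fun a => hg ζ z a (hle.trans bot_le))
    have : g (ζ, z) = 0 := norm_le_zero_iff.1 h0
    simp [this]
  | top =>
    rw [EReal.coe_add_top, EReal.exp_top, ENNReal.mul_top hpos]
    exact le_top
  | coe b =>
    rw [hs] at hle
    rw [← EReal.coe_add, EReal.exp_coe, ← ENNReal.ofReal_mul (by positivity), ← ofReal_norm]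
    refine ENNReal.ofReal_le_ofReal ((hg ζ z b hle).trans ?_)
    have : 0 ≤ (D + 1) * (‖ζ‖ ^ 2 + ‖z.re‖) := by positivity
    gcongr <;> linarith

namespace BernsteinSpace

variable (Φ : HermitianMap E F) (p : ℝ≥0∞) (K : Set (StrongDual ℝ F))

variable {Φ p K} in
theorem norm_def (f : BernsteinSpace Φ p K) :
    ‖f‖ = (eLpNorm (Φ.restr (incl Φ p K f).1 0) p (lebesgue E F)).toReal := rfl

variable {Φ p K} in
theorem eLpNorm_ne_top (f : BernsteinSpace Φ p K) :
    eLpNorm (Φ.restr (incl Φ p K f).1 0) p (lebesgue E F) ≠ ∞ := f.2.2.2.2.ne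

variable {Φ p K} in
theorem expType (f : BernsteinSpace Φ p K) : Φ.ExpType K (incl Φ p K f).1 := f.2.2.1

variable {Φ p K} in
theorem differentiable (f : BernsteinSpace Φ p K) : Differentiable ℂ (incl Φ p K f).1 := f.2.1

/-- Point evaluations on `𝒩` are bounded. -/
theorem exists_norm_restr_le (hK : IsCompact K) (hp : 0 < p) : ∃ C : ℝ, 0 ≤ C ∧
    ∀ (f : BernsteinSpace Φ p K) (ξ : E × F), ‖Φ.restr (incl Φ p K f).1 0 ξ‖ ≤ C * ‖f‖ := by
  rcases eq_or_ne p ∞ with rfl | hpt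
  · refine ⟨1, zero_le_one, fun f => ?_⟩
    obtain ⟨ν, hν, hνe⟩ := exists_lebesgue_eq_prod E F
    have : (lebesgue E F).IsOpenPosMeasure := by rw [hνe]; infer_instance
    have hae := ae_le_eLpNormEssSup (f := Φ.restr (incl Φ ∞ K f).1 0) (μ := lebesgue E F)
    -- A set of full measure is dense, so by continuity the essential bound holds everywhere.
    have hd := Measure.dense_of_ae hae
    have hcl : IsClosed {ξ | ‖Φ.restr (incl Φ ∞ K f).1 0 ξ‖ₑ ≤
        eLpNormEssSup (Φ.restr (incl Φ ∞ K f).1 0) (lebesgue E F)} :=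
      isClosed_le (Φ.continuous_restr f.differentiable.continuous 0).enorm continuous_const
    have huniv := hcl.closure_eq.symm.trans hd.closure_eq
    intro ξ
    have h1 : ‖Φ.restr (incl Φ ∞ K f).1 0 ξ‖ₑ ≤ eLpNorm (Φ.restr (incl Φ ∞ K f).1 0) ∞
        (lebesgue E F) := by
      rw [eLpNorm_exponent_top]
      exact (huniv ▸ mem_univ ξ : ξ ∈ {ξ | ‖Φ.restr (incl Φ ∞ K f).1 0 ξ‖ₑ ≤
        eLpNormEssSup (Φ.restr (incl Φ ∞ K f).1 0) (lebesgue E F)})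
    rw [one_mul, norm_def, ← toReal_enorm]
    exact ENNReal.toReal_mono f.eLpNorm_ne_top h1
  · set q := p.toReal with hq
    have hq0 : 0 < q := ENNReal.toReal_pos hp.ne' hpt
    obtain ⟨C, hC, hle⟩ := Φ.exists_enorm_restr_rpow_le hK hq0
    refine ⟨(C ^ (1 / q)).toReal, ENNReal.toReal_nonneg, fun f ξ => ?_⟩
    have hnorm : eLpNorm (Φ.restr (incl Φ p K f).1 0) p (lebesgue E F) =
        (∫⁻ ξ, ‖Φ.restr (incl Φ p K f).1 0 ξ‖ₑ ^ q ∂(lebesgue E F)) ^ (1 / q) :=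
      eLpNorm_eq_lintegral_rpow_enorm_toReal hp.ne' hpt
    have hfin : ∫⁻ ξ, ‖Φ.restr (incl Φ p K f).1 0 ξ‖ₑ ^ q ∂(lebesgue E F) ≠ ∞ := fun h => by
      have := f.eLpNorm_ne_top
      rw [hnorm, h, ENNReal.top_rpow_of_pos (by positivity)] at this
      exact this rfl
    have h1 := hle _ f.differentiable f.expType hfin ξ
    have h2 : ‖Φ.restr (incl Φ p K f).1 0 ξ‖ₑ ≤
        C ^ (1 / q) * eLpNorm (Φ.restr (incl Φ p K f).1 0) p (lebesgue E F) := by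
      rw [hnorm, ← ENNReal.mul_rpow_of_nonneg _ _ (by positivity), one_div]
      exact (ENNReal.le_rpow_inv_iff hq0).2 h1
    rw [norm_def, ← ENNReal.toReal_mul, ← toReal_enorm]
    exact ENNReal.toReal_mono (ENNReal.mul_ne_top
      (ENNReal.rpow_ne_top_of_nonneg (by positivity) hC) f.eLpNorm_ne_top) h2

/-- The pointwise estimate `|f(ζ, z)| ≤ C ‖f‖ exp(H_K(ρ(ζ, z)))`. -/
theorem exists_norm_apply_le (hK : IsCompact K) (hp : 0 < p) : ∃ C : ℝ, 0 ≤ C ∧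
    ∀ (f : BernsteinSpace Φ p K) (ζ : E) (z : Cplx F) (a : ℝ), suppFun K (Φ.rho ζ z) ≤ a →
      ‖(incl Φ p K f).1 (ζ, z)‖ ≤ C * ‖f‖ * Real.exp a := by
  obtain ⟨C, hC, hle⟩ := exists_norm_restr_le Φ p K hK hp
  refine ⟨C, hC, fun f ζ z a ha => ?_⟩
  rw [Φ.apply_eq_restr (incl Φ p K f).1]
  -- With the bound on `𝒩` known, the supremum form of Phragmén-Lindelöf on the fibre over `ζ`
  -- carries it to height `ρ(ζ, z)`.
  exact f.expType.norm_restr_le f.differentiable ha (fun x => hle f (ζ, x)) _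

/-- Point evaluations are locally uniformly bounded. -/
theorem exists_locally_norm_apply_le (hK : IsCompact K) (hp : 0 < p) (v₀ : E × Cplx F) :
    ∃ C > 0, ∃ t ∈ 𝓝 v₀, ∀ (f : BernsteinSpace Φ p K), ∀ v ∈ t,
      ‖(incl Φ p K f).1 v‖ ≤ C * ‖f‖ := by
  obtain ⟨C, hC, hle⟩ := exists_norm_apply_le Φ p K hK hp
  obtain ⟨R, hR⟩ := hK.isBounded.exists_norm_le
  have hc : Continuous fun v : E × Cplx F => R * ‖Φ.rho v.1 v.2‖ :=
    continuous_const.mul Φ.continuous_rho.norm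
  refine ⟨(C + 1) * Real.exp (R * ‖Φ.rho v₀.1 v₀.2‖ + 1), by positivity,
    {v | R * ‖Φ.rho v.1 v.2‖ < R * ‖Φ.rho v₀.1 v₀.2‖ + 1},
    hc.continuousAt.eventually (gt_mem_nhds (lt_add_one _)), fun f v hv => ?_⟩
  have hf : 0 ≤ ‖f‖ := ENNReal.toReal_nonneg
  refine (hle f v.1 v.2 _ (suppFun_le_mul_norm hR _)).trans ?_
  calc C * ‖f‖ * Real.exp (R * ‖Φ.rho v.1 v.2‖)
      ≤ (C + 1) * ‖f‖ * Real.exp (R * ‖Φ.rho v₀.1 v₀.2‖ + 1) := by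
        have : R * ‖Φ.rho v.1 v.2‖ ≤ R * ‖Φ.rho v₀.1 v₀.2‖ + 1 := le_of_lt hv
        gcongr
        linarith
    _ = _ := by ring

theorem ext_incl {f g : BernsteinSpace Φ p K}
    (h : ∀ v, (incl Φ p K f).1 v = (incl Φ p K g).1 v) : f = g :=
  Subtype.ext (ContinuousMap.ext h)

theorem norm_smul' (c : ℂ) (f : BernsteinSpace Φ p K) : ‖c • f‖ = ‖c‖ * ‖f‖ := by
  have h : Φ.restr (incl Φ p K (c • f)).1 0 = c • Φ.restr (incl Φ p K f).1 0 := rfl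
  rw [norm_def, h, eLpNorm_const_smul, ENNReal.toReal_mul, toReal_enorm, norm_def]

theorem norm_eq_zero_iff' (hK : IsCompact K) (hp : 0 < p) (f : BernsteinSpace Φ p K) :
    ‖f‖ = 0 ↔ f = 0 := by
  constructor
  · intro h
    refine ext_incl Φ p K fun v => ?_
    obtain ⟨C, -, t, ht, hle⟩ := exists_locally_norm_apply_le Φ p K hK hp v
    have h1 := hle f v (mem_of_mem_nhds ht)
    rw [h, mul_zero] at h1
    exact norm_le_zero_iff.1 h1
  · rintro rfl
    have := norm_smul' Φ p K 0 0
    simpa using this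

theorem restr_aestronglyMeasurable (f : BernsteinSpace Φ p K) :
    AEStronglyMeasurable (Φ.restr (incl Φ p K f).1 0) (lebesgue E F) := f.2.2.2.1

theorem norm_add_le_mul (f g : BernsteinSpace Φ p K) :
    ‖f + g‖ ≤ (ENNReal.LpAddConst p).toReal * (‖f‖ + ‖g‖) := by
  have h : Φ.restr (incl Φ p K (f + g)).1 0 =
    Φ.restr (incl Φ p K f).1 0 + Φ.restr (incl Φ p K g).1 0 := rfl
  rw [norm_def, h, norm_def, norm_def,
    ← ENNReal.toReal_add f.eLpNorm_ne_top g.eLpNorm_ne_top, ← ENNReal.toReal_mul]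
  exact ENNReal.toReal_mono (ENNReal.mul_ne_top (ENNReal.LpAddConst_lt_top p).ne
    (ENNReal.add_ne_top.2 ⟨f.eLpNorm_ne_top, g.eLpNorm_ne_top⟩))
    (eLpNorm_add_le' (restr_aestronglyMeasurable Φ p K f) (restr_aestronglyMeasurable Φ p K g) p)

theorem isQuasiNorm (hK : IsCompact K) (hp : 0 < p) :
    IsQuasiNorm (fun f : BernsteinSpace Φ p K => ‖f‖) where
  nonneg _ := ENNReal.toReal_nonneg
  eq_zero_iff := norm_eq_zero_iff' Φ p K hK hp
  smul := norm_smul' Φ p K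
  add_le := ⟨max 1 (ENNReal.LpAddConst p).toReal, le_max_left _ _, fun f g =>
    (norm_add_le_mul Φ p K f g).trans (mul_le_mul_of_nonneg_right (le_max_right _ _)
      (add_nonneg ENNReal.toReal_nonneg ENNReal.toReal_nonneg))⟩

theorem normedSpaceCore (hK : IsCompact K) (hp : 1 ≤ p) :
    NormedSpace.Core ℂ (BernsteinSpace Φ p K) where
  norm_nonneg _ := ENNReal.toReal_nonneg
  norm_smul := norm_smul' Φ p K
  norm_triangle f g := by
    simpa [ENNReal.LpAddConst_of_one_le hp] using norm_add_le_mul Φ p K f g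
  norm_eq_zero_iff := norm_eq_zero_iff' Φ p K hK (zero_lt_one.trans_le hp)

/-- Cauchy sequences converge. -/
theorem exists_tendsto_of_cauchy (hK : IsCompact K) (hp : 0 < p) (f : ℕ → BernsteinSpace Φ p K)
    (hf : ∀ ε > 0, ∃ N, ∀ m ≥ N, ∀ n ≥ N, ‖f m - f n‖ < ε) :
    ∃ g : BernsteinSpace Φ p K, ∀ ε > 0, ∃ N, ∀ n ≥ N, ‖f n - g‖ < ε := by
  let φ : ℕ → E × Cplx F → ℂ := fun n => (incl Φ p K (f n)).1
  have hsub : ∀ m n v, (incl Φ p K (f m - f n)).1 v = φ m v - φ n v := fun _ _ _ => rfl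
  have hlim : ∀ v, ∃ l, Filter.Tendsto (fun n => φ n v) Filter.atTop (𝓝 l) := by
    intro v
    refine cauchySeq_tendsto_of_complete (Metric.cauchySeq_iff.2 fun ε hε => ?_)
    obtain ⟨C, hC, t, ht, hle⟩ := exists_locally_norm_apply_le Φ p K hK hp v
    obtain ⟨N, hN⟩ := hf (ε / C) (by positivity)
    refine ⟨N, fun m hm n hn => ?_⟩
    rw [dist_eq_norm, ← hsub]
    refine (hle _ v (mem_of_mem_nhds ht)).trans_lt ?_
    have := hN m hm n hn
    rwa [lt_div_iff₀' hC] at this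
  choose g hg using hlim
  have hgsub : ∀ n v, Filter.Tendsto (fun m => φ n v - φ m v) Filter.atTop (𝓝 (φ n v - g v)) :=
    fun n v => tendsto_const_nhds.sub (hg v)
  have hloc : ∀ v₀, ∃ t ∈ 𝓝 v₀, TendstoUniformlyOn φ g Filter.atTop t := by
    intro v₀
    obtain ⟨C, hC, t, ht, hle⟩ := exists_locally_norm_apply_le Φ p K hK hp v₀
    refine ⟨t, ht, Metric.tendstoUniformlyOn_iff.2 fun ε hε => ?_⟩
    obtain ⟨N, hN⟩ := hf (ε / 2 / C) (by positivity)
    refine Filter.eventually_atTop.2 ⟨N, fun n hn v hv => ?_⟩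
    rw [dist_comm, dist_eq_norm]
    refine lt_of_le_of_lt ?_ (half_lt_self hε)
    refine le_of_tendsto (hgsub n v).norm (Filter.eventually_atTop.2 ⟨N, fun m hm => ?_⟩)
    rw [← hsub]
    refine (hle _ v hv).trans ?_
    have := hN n hn m hm
    rw [lt_div_iff₀' hC] at this
    exact this.le
  have hgd : Differentiable ℂ g := Differentiable.of_tendstoUniformlyOn_nhds hloc fun n => (f n).differentiable
  have hgexp : Φ.ExpType K g := by
    obtain ⟨C, hC, hle⟩ := exists_norm_apply_le Φ p K hK hp
    obtain ⟨N, hN⟩ := hf 1 one_pos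
    -- The difference `φ N - g` inherits the uniform estimate as a pointwise limit, and `g` is
    -- recovered as `φ N - (φ N - g)`.
    have h1 : Φ.ExpType K fun v => φ N v - g v := by
      refine HermitianMap.ExpType.of_norm_le hC fun ζ z a ha => ?_
      refine le_of_tendsto (hgsub N (ζ, z)).norm (Filter.eventually_atTop.2 ⟨N, fun m hm => ?_⟩)
      rw [← hsub]
      refine (hle _ ζ z a ha).trans ?_
      have := (hN N le_rfl m hm).le
      gcongr
      exact mul_le_of_le_one_right hC this
    have h2 := (f N).expType.add (h1.smul (-1))
    refine Eq.mp (congrArg _ (funext fun v => ?_)) h2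
    change φ N v + -1 * (φ N v - g v) = g v
    ring
  have hgc : Continuous g := hgd.continuous
  have hcont : ∀ n, Continuous (φ n) := fun n => (f n).differentiable.continuous
  have hle : ∀ ε : ℝ, 0 < ε → ∃ N, ∀ n ≥ N,
      eLpNorm (Φ.restr (fun v => φ n v - g v) 0) p (lebesgue E F) ≤ ENNReal.ofReal ε := by
    intro ε hε
    obtain ⟨N, hN⟩ := hf ε hε
    -- Fatou's lemma, as `m → ∞`.
    refine ⟨N, fun n hn => Lp.eLpNorm_le_of_ae_tendsto (u := Filter.atTop)
      (f := fun m => Φ.restr (incl Φ p K (f n - f m)).1 0)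
      (Filter.eventually_atTop.2 ⟨N, fun m hm => ?_⟩)
      (fun m => restr_aestronglyMeasurable Φ p K _)
      (Filter.Eventually.of_forall fun ξ => hgsub n _)⟩
    rw [← ENNReal.ofReal_toReal (f n - f m).eLpNorm_ne_top]
    exact ENNReal.ofReal_le_ofReal (hN n hn m hm).le
  have hmeas : AEStronglyMeasurable (Φ.restr g 0) (lebesgue E F) :=
    (Φ.continuous_restr hgc 0).aestronglyMeasurable
  have hmem : MemLp (Φ.restr g 0) p (lebesgue E F) := by
    obtain ⟨N, hN⟩ := hle 1 one_pos
    have h1 : MemLp (Φ.restr (fun v => φ N v - g v) 0) p (lebesgue E F) :=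
      ⟨(Φ.continuous_restr ((hcont N).sub hgc) 0).aestronglyMeasurable,
        (hN N le_rfl).trans_lt ENNReal.ofReal_lt_top⟩
    have h2 := (f N).2.2.2.sub h1
    refine Eq.mp (congrArg (fun u => MemLp u p _) (funext fun ξ => ?_)) h2
    exact sub_sub_cancel _ _
  refine ⟨⟨⟨g, hgc⟩, hgd, hgexp, hmem⟩, fun ε hε => ?_⟩
  obtain ⟨N, hN⟩ := hle (ε / 2) (by positivity)
  refine ⟨N, fun n hn => lt_of_le_of_lt ?_ (half_lt_self hε)⟩
  exact ENNReal.toReal_le_of_le_ofReal (by positivity) (hN n hn)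

end BernsteinSpace

/-! ### From Cauchy sequences to completeness; the main theorem -/

theorem IsQuasiNorm.hasBasis_uniformity {V : Type*} [AddCommGroup V] [Module ℂ V] {q : V → ℝ}
    (hq : IsQuasiNorm q) : (@uniformity V hq.uniformSpace).HasBasis (fun ε : ℝ => 0 < ε)
      fun ε => {z | q (z.1 - z.2) < ε} := by
  refine ⟨fun s => ?_⟩
  have h := hq.filterBasis.hasBasis.mem_iff (t := s)
  refine h.trans ⟨?_, ?_⟩
  · rintro ⟨_, ⟨ε, hε, rfl⟩, hs⟩
    exact ⟨ε, hε, hs⟩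
  · rintro ⟨ε, hε, hs⟩
    exact ⟨_, ⟨ε, hε, rfl⟩, hs⟩

/-- A quasi-normed space in which Cauchy sequences converge is complete. -/
theorem IsQuasiNorm.completeSpace {V : Type*} [AddCommGroup V] [Module ℂ V] {q : V → ℝ}
    (hq : IsQuasiNorm q) (h : ∀ f : ℕ → V, (∀ ε > 0, ∃ N, ∀ m ≥ N, ∀ n ≥ N, q (f m - f n) < ε) →
      ∃ g, ∀ ε > 0, ∃ N, ∀ n ≥ N, q (f n - g) < ε) : @CompleteSpace V hq.uniformSpace := by
  let := hq.uniformSpace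
  have hb : (uniformity V).HasBasis (fun ε : ℝ => 0 < ε) fun ε => {z | q (z.1 - z.2) < ε} :=
    hq.hasBasis_uniformity
  -- A countable basis of entourages, given by the radii `1 / (n + 1)`, makes sequences suffice for
  -- completeness.
  have hcg : (uniformity V).IsCountablyGenerated := by
    have : (uniformity V).HasBasis (fun _ : ℕ => True)
        fun n => {z | q (z.1 - z.2) < 1 / ((n : ℝ) + 1)} := by
      refine hb.to_hasBasis (fun ε hε => ?_) fun n _ => ⟨_, Nat.one_div_pos_of_nat, subset_rfl⟩
      obtain ⟨n, hn⟩ := exists_nat_one_div_lt hε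
      exact ⟨n, trivial, fun z hz => lt_trans hz hn⟩
    exact this.isCountablyGenerated
  refine UniformSpace.complete_of_cauchySeq_tendsto fun u hu => ?_
  obtain ⟨g, hg⟩ := h u fun ε hε => by
    obtain ⟨N, hN⟩ := hb.cauchySeq_iff.1 hu ε hε
    exact ⟨N, fun m hm n hn => hN m hm n hn⟩
  refine ⟨g, (nhds_basis_uniformity hb).tendsto_right_iff.2 fun ε hε => ?_⟩
  exact Filter.eventually_atTop.2 (hg ε hε)

end Main

theorem corollary3p3 {E F : Type*}
    [NormedAddCommGroup E] [InnerProductSpace ℂ E] [FiniteDimensional ℂ E]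
    [MeasurableSpace E] [BorelSpace E]
    [NormedAddCommGroup F] [InnerProductSpace ℝ F] [FiniteDimensional ℝ F]
    [MeasurableSpace F] [BorelSpace F]
    (Φ : HermitianMap E F) (K : Set (StrongDual ℝ F)) (hK : IsCompact K) (hKc : Convex ℝ K)
    (p : ℝ≥0∞) (hp : 0 < p) :
    (∃ hq : IsQuasiNorm (fun f : BernsteinSpace Φ p K => ‖f‖),
      @CompleteSpace (BernsteinSpace Φ p K) hq.uniformSpace ∧
      Function.Injective (BernsteinSpace.incl Φ p K) ∧
      @Continuous (BernsteinSpace Φ p K) (Hol E F) hq.uniformSpace.toTopologicalSpace inferInstance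
        (BernsteinSpace.incl Φ p K)) ∧
    (1 ≤ p → ∃ hn : NormedSpace.Core ℂ (BernsteinSpace Φ p K),
      @CompleteSpace (BernsteinSpace Φ p K)
        (NormedAddCommGroup.ofCore hn).toMetricSpace.toPseudoMetricSpace.toUniformSpace) := by
  have hseq := BernsteinSpace.exists_tendsto_of_cauchy Φ p K hK hp
  refine ⟨⟨BernsteinSpace.isQuasiNorm Φ p K hK hp, ?_, ?_, ?_⟩, fun hp1 =>
    ⟨BernsteinSpace.normedSpaceCore Φ p K hK hp1, ?_⟩⟩
  · exact IsQuasiNorm.completeSpace _ hseq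
  · intro f g h
    exact BernsteinSpace.ext_incl Φ p K fun v => by rw [h]
  · let hq := BernsteinSpace.isQuasiNorm Φ p K hK hp
    let := hq.uniformSpace
    -- `Hol` carries the compact-open topology, so locally uniform convergence is enough; it follows
    -- from the local bounds on point evaluations, applied to `g - f`.
    refine continuous_induced_rng.2 (continuous_iff_continuousAt.2 fun f => ?_)
    refine ContinuousMap.tendsto_of_tendstoLocallyUniformly ?_
    rw [Metric.tendstoLocallyUniformly_iff]
    intro ε hε v₀
    obtain ⟨C, hC, t, ht, hle⟩ :=
      BernsteinSpace.exists_locally_norm_apply_le Φ p K hK hp v₀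
    refine ⟨t, ht, ?_⟩
    filter_upwards [(nhds_basis_uniformity hq.hasBasis_uniformity).mem_of_mem
      (div_pos hε hC)] with g hg v hv
    have hg : ‖g - f‖ < ε / C := hg
    rw [lt_div_iff₀' hC] at hg
    rw [dist_comm, dist_eq_norm]
    exact (hle (g - f) v hv).trans_lt hg
  · let := NormedAddCommGroup.ofCore (BernsteinSpace.normedSpaceCore Φ p K hK hp1)
    refine Metric.complete_of_cauchySeq_tendsto fun u hu => ?_
    obtain ⟨g, hg⟩ := hseq u fun ε hε => by
      obtain ⟨N, hN⟩ := Metric.cauchySeq_iff.1 hu ε hε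
      exact ⟨N, fun m hm n hn => by simpa only [dist_eq_norm] using hN m hm n hn⟩
    refine ⟨g, Metric.tendsto_atTop.2 fun ε hε => ?_⟩
    obtain ⟨N, hN⟩ := hg ε hε
    exact ⟨N, fun n hn => by simpa only [dist_eq_norm] using hN n hn⟩
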